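/- **Category.** Let $\mathbf{SL}$ be the category whose objects are the semi-linear sets $A\subset\mathbb R^n$, $n\ge 0$ (finite unions of solution sets of finite systems of affine equations and weak or strict affine inequalities), and whose morphisms $(A\subset\mathbb R^n)\to(B\subset\mathbb R^m)$ are the maps $A\to B$ that are restrictions of affine maps $\mathbb R^n\to\mathbb R^m$. Let $\mathcal A$ be the set of the following morphisms of $\mathbf{SL}$: the scalar multiplications $\mathbb R\xrightarrow{c}\mathbb R$ for $c\in\mathbb R$, the addition $\mathbb R^2\xrightarrow{+}\mathbb R$, the inclusion $[0,\infty)\hookrightarrow\mathbb R$, and $\mathbb R\to 0=\mathbb R^0$. **Limit complexity.** A diagram in a category $\mathcal C$ is a directed graph $I$ (loops and multiple edges allowed) with a graph homomorphism from $I$ to the underlying graph of $\mathcal C$; a subdiagram on a set of vertices contains all edges between them. Given a set $\mathcal B$ of morphisms of $\mathcal C$ ("basic morphisms"), a *limit computation* is a sequence of diagrams $(D_0,\dots,D_s)$ such that (i) $D_0$ is finite and consists of basic morphisms (every edge is in $\mathcal B$, every vertex is an endpoint of an edge); (ii) $D_i$ arises from $D_{i-1}$ by adding a limit cone over the subdiagram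 of $D_{i-1}$ on some set $J_i$ of vertices (one new vertex, and one new edge from it to each vertex in $J_i$); (iii) (constructivity) if $J_j$ contains the vertex added in step $i<j$, then $J_i\subset J_j$. Its cost is $s$ plus the number of edges of $D_0$, and it computes a diagram $D$ if $D$ is isomorphic to a (not necessarily full) subdiagram of $D_s$. The limit complexity $c^{\lim}_{\mathcal C,\mathcal B}(D)\in\mathbb N\cup\{\infty\}$ is the least cost of a limit computation that computes $D$ ($\infty$ if there is none). A diagram $D$ in the arrow category $\mathcal C^{\bullet\to\bullet}$ induces a diagram $D'$ in $\mathcal C$ (two copies of the graph of $D$, for the sources and the targets of the arrows, joined by one edge for each vertex $v$ of $D$, which carries the arrow $D(v)$), and one puts $c^{\lim}_{\mathcal C^{\bullet\to\bullet},\mathcal B}(D)=c^{\lim}_{\mathcal C,\mathcal B}(D')$; the same for diagrams in the full subcategory $\mathrm{Mon}_{\mathcal C}\subset\mathcal C^{\bullet\to\bullet}$ of monomorphisms. **Image functor.** $\mathrm{im}_{\mathbf{SL}}:\mathbf{SL}^{\bullet\to\bullet}\to\mathrm{Mon}_{\mathbf{SL}}$ is the left adjoint of the inclusion $\mathrm{Mon}_{\mathbf{SL}}\to\mathbf{SL}^{\bullet\to\bullet}$.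 For a set $\mathcal B$ of basic morphisms let $$C_{\mathcal B}(\mathrm{im}_{\mathbf{SL}})(n)=\sup\{\,c^{\lim}_{\mathbf{SL}^{\bullet\to\bullet},\mathcal B}(\mathrm{im}_{\mathbf{SL}}(D)) \;:\; D \text{ a finite diagram in } \mathbf{SL}^{\bullet\to\bullet},\ c^{\lim}_{\mathbf{SL}^{\bullet\to\bullet},\mathcal B}(D)\le n\,\}\in\mathbb N\cup\{\infty\}.$$ Let $C^{\mathrm{ob}}_{\mathcal B}(\mathrm{im}_{\mathbf{SL}})(n)\le C_{\mathcal B}(\mathrm{im}_{\mathbf{SL}})(n)$ be the same supremum restricted to diagrams $D$ with one vertex and no edges, that is, to single morphisms of $\mathbf{SL}$. **Proposition.** 1. The function $C_{\mathcal A}(\mathrm{im}_{\mathbf{SL}})$ is not polynomially bounded: there is no polynomial $p\in\mathbb N[x]$ with $C_{\mathcal A}(\mathrm{im}_{\mathbf{SL}})(n)\le p(n)$ for all $n\in\mathbb N$. 2. Let $\mathcal B$ be any set of morphisms of $\mathbf{SL}$ that contains $\mathcal A$ and the two coordinate projections $\pi_1,\pi_2:\mathbb R^2\to\mathbb R$,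 and is contained in the union of $\mathcal A$, $\{\pi_1,\pi_2\}$ and the set of constants $0\xrightarrow{c}\mathbb R$, $c\in\mathbb R$. Then even $C^{\mathrm{ob}}_{\mathcal B}(\mathrm{im}_{\mathbf{SL}})$ (hence also $C_{\mathcal B}(\mathrm{im}_{\mathbf{SL}})$) is not polynomially bounded. -/

import Mathlib

open CategoryTheory

namespace CategoricalComplexity

/-! ### Semi-linear sets -/

section Semilinear

variable {E F : Type*} [AddCommGroup E] [Module ℝ E] [AddCommGroup F] [Module ℝ F]

/-- The solution set of a finite system of affine inequalities, some weak and some strict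
(an affine equation `l = 0` is the pair `0 ≤ l`, `0 ≤ -l`). -/
def IsBasicSemilinear (S : Set E) : Prop :=
  ∃ N W : Set (E →ᵃ[ℝ] ℝ), N.Finite ∧ W.Finite ∧
    S = {x | (∀ l ∈ N, 0 ≤ l x) ∧ ∀ l ∈ W, 0 < l x}

/-- A semi-linear set: a finite union of solution sets of finite systems of affine equations and
(weak or strict) affine inequalities; equivalently, a finite Boolean combination of half-spaces. -/
def IsSemilinear (S : Set E) : Prop :=
  ∃ P : Set (Set E), P.Finite ∧ (∀ T ∈ P, IsBasicSemilinear T) ∧ S = ⋃₀ P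

theorem IsBasicSemilinear.isSemilinear {S : Set E} (h : IsBasicSemilinear S) : IsSemilinear S :=
  ⟨{S}, Set.finite_singleton S, by simpa using h, by simp⟩

theorem isBasicSemilinear_univ : IsBasicSemilinear (Set.univ : Set E) :=
  ⟨∅, ∅, Set.finite_empty, Set.finite_empty, by simp⟩

theorem isBasicSemilinear_nonneg (l : E →ᵃ[ℝ] ℝ) : IsBasicSemilinear {x | 0 ≤ l x} :=
  ⟨{l}, ∅, Set.finite_singleton l, Set.finite_empty, by simp⟩

theorem isBasicSemilinear_pos (l : E →ᵃ[ℝ] ℝ) : IsBasicSemilinear {x | 0 < l x} :=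
  ⟨∅, {l}, Set.finite_empty, Set.finite_singleton l, by simp⟩

theorem IsBasicSemilinear.inter {S T : Set E} (hS : IsBasicSemilinear S)
    (hT : IsBasicSemilinear T) : IsBasicSemilinear (S ∩ T) := by
  obtain ⟨N, W, hN, hW, rfl⟩ := hS
  obtain ⟨N', W', hN', hW', rfl⟩ := hT
  refine ⟨N ∪ N', W ∪ W', hN.union hN', hW.union hW', ?_⟩
  ext x
  simp only [Set.mem_inter_iff, Set.mem_ofPred_eq, Set.mem_union]
  constructor
  · rintro ⟨⟨h1, h2⟩, h3, h4⟩
    exact ⟨fun l hl => hl.elim (h1 l) (h3 l), fun l hl => hl.elim (h2 l) (h4 l)⟩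
  · rintro ⟨h1, h2⟩
    exact ⟨⟨fun l hl => h1 l (.inl hl), fun l hl => h2 l (.inl hl)⟩,
      fun l hl => h1 l (.inr hl), fun l hl => h2 l (.inr hl)⟩

theorem isBasicSemilinear_biInter {ι : Type*} {K : Set ι} (hK : K.Finite) {S : ι → Set E}
    (h : ∀ i ∈ K, IsBasicSemilinear (S i)) : IsBasicSemilinear (⋂ i ∈ K, S i) := by
  induction K, hK using Set.Finite.induction_on with
  | empty => simpa using isBasicSemilinear_univ
  | insert _ _ ih =>
    rw [Set.biInter_insert]
    exact (h _ (Set.mem_insert _ _)).inter (ih fun i hi => h i (Set.mem_insert_of_mem _ hi))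

theorem isBasicSemilinear_eqZero (l : E →ᵃ[ℝ] ℝ) : IsBasicSemilinear {x | l x = 0} := by
  have h := (isBasicSemilinear_nonneg l).inter (isBasicSemilinear_nonneg (-l))
  convert h using 1
  ext x
  simp only [Set.mem_ofPred_eq, Set.mem_inter_iff, AffineMap.coe_neg, Pi.neg_apply]
  constructor
  · intro h; simp [h]
  · rintro ⟨h1, h2⟩; exact le_antisymm (by linarith) h1

theorem IsBasicSemilinear.preimage {S : Set F} (hS : IsBasicSemilinear S) (g : E →ᵃ[ℝ] F) :
    IsBasicSemilinear (g ⁻¹' S) := by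
  obtain ⟨N, W, hN, hW, rfl⟩ := hS
  refine ⟨(fun l => l.comp g) '' N, (fun l => l.comp g) '' W, hN.image _, hW.image _, ?_⟩
  ext x
  simp

theorem IsSemilinear.preimage {S : Set F} (hS : IsSemilinear S) (g : E →ᵃ[ℝ] F) :
    IsSemilinear (g ⁻¹' S) := by
  obtain ⟨P, hP, hb, rfl⟩ := hS
  refine ⟨(fun T => g ⁻¹' T) '' P, hP.image _, ?_, ?_⟩
  · rintro _ ⟨T, hT, rfl⟩
    exact (hb T hT).preimage g
  · ext x
    simp

theorem IsSemilinear.inter_basic {S T : Set E} (hS : IsSemilinear S)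
    (hT : IsBasicSemilinear T) : IsSemilinear (S ∩ T) := by
  obtain ⟨P, hP, hb, rfl⟩ := hS
  refine ⟨(fun U => U ∩ T) '' P, hP.image _, ?_, ?_⟩
  · rintro _ ⟨U, hU, rfl⟩
    exact (hb U hU).inter hT
  · rw [Set.sUnion_image, Set.sUnion_eq_biUnion, Set.iUnion₂_inter]

/-- Strict (`b = true`) or weak positivity. -/
def signCond (b : Bool) (r : ℝ) : Prop := (b = true → 0 < r) ∧ 0 ≤ r

theorem isBasicSemilinear_signCond (b : Bool) (l : E →ᵃ[ℝ] ℝ) :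
    IsBasicSemilinear {x | signCond b (l x)} := by
  cases b
  · simpa [signCond] using isBasicSemilinear_nonneg l
  · convert isBasicSemilinear_pos l using 3
    simp only [signCond]
    exact ⟨fun h => h.1 trivial, fun h => ⟨fun _ => h, h.le⟩⟩

theorem signCond_mul {b : Bool} {a r : ℝ} (ha : 0 < a) (h : signCond b r) :
    signCond b (a * r) :=
  ⟨fun hb => mul_pos ha (h.1 hb), mul_nonneg ha.le h.2⟩

theorem signCond_of_pos {b : Bool} {r : ℝ} (h : 0 < r) : signCond b r := ⟨fun _ => h, h.le⟩

theorem signCond_or_left {b b' : Bool} {r : ℝ} (h : signCond (b || b') r) : signCond b r :=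
  ⟨fun hb => h.1 (by simp [hb]), h.2⟩

theorem signCond_or_right {b b' : Bool} {r : ℝ} (h : signCond (b || b') r) : signCond b' r :=
  ⟨fun hb => h.1 (by simp [hb]), h.2⟩

theorem signCond_add {b b' : Bool} {r r' : ℝ} (h : signCond b r) (h' : signCond b' r') :
    signCond (b || b') (r + r') := by
  refine ⟨fun hb => ?_, add_nonneg h.2 h'.2⟩
  rcases Bool.or_eq_true _ _ ▸ hb with hb | hb
  · exact add_pos_of_pos_of_nonneg (h.1 hb) h'.2
  · exact add_pos_of_nonneg_of_pos h.2 (h'.1 hb)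

theorem exists_signCond_opp {b b' : Bool} {a a' c c' : ℝ} (hc : 0 < c) (hc' : c' < 0) :
    (∃ t, signCond b (a + c * t) ∧ signCond b' (a' + c' * t)) ↔
      signCond (b || b') (-c' * a + c * a') := by
  constructor
  · rintro ⟨t, h, h'⟩
    have := signCond_add (signCond_mul (neg_pos.2 hc') h) (signCond_mul hc h')
    convert this using 1
    ring
  · intro h
    have hn : c' ≠ 0 := hc'.ne
    have hp : c ≠ 0 := hc.ne'
    refine ⟨(-a / c + -a' / c') / 2, ?_, ?_⟩
    · have h1 : a + c * ((-a / c + -a' / c') / 2) = (1 / (2 * -c')) * (-c' * a + c * a') := by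
        field_simp
        ring
      rw [h1]
      have : 0 < -c' := neg_pos.2 hc'
      exact signCond_mul (by positivity) (signCond_or_left h)
    · have h1 : a' + c' * ((-a / c + -a' / c') / 2) = (1 / (2 * c)) * (-c' * a + c * a') := by
        field_simp
        ring
      rw [h1]
      exact signCond_mul (by positivity) (signCond_or_right h)

theorem exists_signCond_pos {b b' : Bool} {a a' c c' : ℝ} (hc : 0 < c) (hc' : 0 < c') :
    ∃ t, signCond b (a + c * t) ∧ signCond b' (a' + c' * t) := by
  refine ⟨(|a| + 1) / c + (|a'| + 1) / c', signCond_of_pos ?_, signCond_of_pos ?_⟩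
  · have h1 : c * ((|a| + 1) / c + (|a'| + 1) / c') = |a| + 1 + c * ((|a'| + 1) / c') := by
      field_simp
    have h2 : 0 < c * ((|a'| + 1) / c') := by positivity
    have := neg_abs_le a
    linarith
  · have h1 : c' * ((|a| + 1) / c + (|a'| + 1) / c') = |a'| + 1 + c' * ((|a| + 1) / c) := by
      field_simp
      ring
    have h2 : 0 < c' * ((|a| + 1) / c) := by positivity
    have := neg_abs_le a'
    linarith

theorem exists_signCond_single {b : Bool} {a c : ℝ} (hc : c ≠ 0) :
    ∃ t, signCond b (a + c * t) := by
  refine ⟨(1 - a) / c, ?_⟩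
  have : a + c * ((1 - a) / c) = 1 := by field_simp; ring
  rw [this]
  exact signCond_of_pos one_pos

theorem isBasicSemilinear_exists_pair (b b' : Bool) (l l' : E →ᵃ[ℝ] ℝ) (c c' : ℝ) :
    IsBasicSemilinear {x | ∃ t : ℝ, signCond b (l x + c * t) ∧ signCond b' (l' x + c' * t)} := by
  rcases lt_trichotomy c 0 with hc | rfl | hc <;> rcases lt_trichotomy c' 0 with hc' | rfl | hc'
  · convert isBasicSemilinear_univ (E := E)
    rw [Set.eq_univ_iff_forall]
    intro x
    obtain ⟨t, h⟩ := exists_signCond_pos (b := b) (b' := b') (a := l x) (a' := l' x)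
      (neg_pos.2 hc) (neg_pos.2 hc')
    exact ⟨-t, by simpa using h⟩
  · convert isBasicSemilinear_signCond b' l' using 3
    simp only [zero_mul, add_zero]
    exact ⟨fun ⟨_, h⟩ => h.2, fun h => ⟨_, (exists_signCond_single hc.ne).choose_spec, h⟩⟩
  · convert isBasicSemilinear_signCond (b' || b) ((-c) • l' + c' • l) using 3
    refine Iff.trans ?_ (exists_signCond_opp (b := b') (b' := b) hc' hc)
    simp only [and_comm]
  · convert isBasicSemilinear_signCond b l using 3
    simp only [zero_mul, add_zero]
    exact ⟨fun ⟨_, h⟩ => h.1, fun h => ⟨_, h, (exists_signCond_single hc'.ne).choose_spec⟩⟩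
  · convert (isBasicSemilinear_signCond b l).inter (isBasicSemilinear_signCond b' l') using 1
    ext x
    simp
  · convert isBasicSemilinear_signCond b l using 3
    simp only [zero_mul, add_zero]
    exact ⟨fun ⟨_, h⟩ => h.1, fun h => ⟨_, h, (exists_signCond_single hc'.ne').choose_spec⟩⟩
  · convert isBasicSemilinear_signCond (b || b') ((-c') • l + c • l') using 3
    rw [exists_signCond_opp hc hc']
    rfl
  · convert isBasicSemilinear_signCond b' l' using 3
    simp only [zero_mul, add_zero]
    exact ⟨fun ⟨_, h⟩ => h.2, fun h => ⟨_, (exists_signCond_single hc.ne').choose_spec, h⟩⟩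
  · convert isBasicSemilinear_univ (E := E)
    rw [Set.eq_univ_iff_forall]
    intro x
    exact exists_signCond_pos hc hc'

theorem convex_signCond (b : Bool) (a c : ℝ) : Convex ℝ {t : ℝ | signCond b (a + c * t)} := by
  intro x hx y hy u v hu hv huv
  have key : a + c * (u • x + v • y) = u * (a + c * x) + v * (a + c * y) := by
    simp only [smul_eq_mul]
    linear_combination (-a) * huv
  simp only [Set.mem_ofPred_eq, key]
  rcases hu.eq_or_lt with rfl | hu'
  · have : v = 1 := by linarith
    subst this
    simpa using hy
  rcases hv.eq_or_lt with rfl | hv'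
  · have : u = 1 := by linarith
    subst this
    simpa using hx
  simpa using signCond_add (signCond_mul hu' hx) (signCond_mul hv' hy)

/-- Elimination of one real variable. -/
theorem IsBasicSemilinear.image_fst {S : Set (E × ℝ)} (hS : IsBasicSemilinear S) :
    IsBasicSemilinear (Prod.fst '' S) := by
  classical
  obtain ⟨N, W, hN, hW, rfl⟩ := hS
  let α : (E × ℝ →ᵃ[ℝ] ℝ) → (E →ᵃ[ℝ] ℝ) := fun l =>
    l.comp (LinearMap.inl ℝ E ℝ).toAffineMap
  let c : (E × ℝ →ᵃ[ℝ] ℝ) → ℝ := fun l => l.linear (0, 1)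
  have hl : ∀ (l : E × ℝ →ᵃ[ℝ] ℝ) x t, l (x, t) = α l x + c l * t := by
    intro l x t
    have h1 : ((x, t) : E × ℝ) = t • ((0 : E), (1 : ℝ)) +ᵥ ((x, 0) : E × ℝ) := by simp
    rw [h1, AffineMap.map_vadd, map_smul]
    simp only [α, c, vadd_eq_add, smul_eq_mul, AffineMap.comp_apply, LinearMap.coe_toAffineMap,
      LinearMap.inl_apply]
    ring
  let K : Set ((E × ℝ →ᵃ[ℝ] ℝ) × Bool) := (fun l => (l, false)) '' N ∪ (fun l => (l, true)) '' W
  have hK : K.Finite := (hN.image _).union (hW.image _)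
  have key : Prod.fst '' {x : E × ℝ | (∀ l ∈ N, 0 ≤ l x) ∧ ∀ l ∈ W, 0 < l x} =
      ⋂ p ∈ K ×ˢ K, {x | ∃ t : ℝ, signCond p.1.2 (α p.1.1 x + c p.1.1 * t) ∧
        signCond p.2.2 (α p.2.1 x + c p.2.1 * t)} := by
    ext x
    have h0 : x ∈ Prod.fst '' {x : E × ℝ | (∀ l ∈ N, 0 ≤ l x) ∧ ∀ l ∈ W, 0 < l x} ↔
        ∃ t, ∀ k ∈ K, signCond k.2 (α k.1 x + c k.1 * t) := by
      constructor
      · rintro ⟨⟨x, t⟩, ⟨h1, h2⟩, rfl⟩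
        refine ⟨t, ?_⟩
        rintro k (⟨l, hl', rfl⟩ | ⟨l, hl', rfl⟩)
        · exact ⟨by simp, by rw [← hl]; exact h1 l hl'⟩
        · exact signCond_of_pos (by rw [← hl]; exact h2 l hl')
      · rintro ⟨t, h⟩
        refine ⟨(x, t), ⟨fun l hl' => ?_, fun l hl' => ?_⟩, rfl⟩
        · rw [hl]; exact (h (l, false) (.inl ⟨l, hl', rfl⟩)).2
        · rw [hl]; exact (h (l, true) (.inr ⟨l, hl', rfl⟩)).1 rfl
    rw [h0]
    simp only [Set.mem_iInter, Set.mem_prod, Set.mem_ofPred_eq]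
    constructor
    · rintro ⟨t, h⟩ p ⟨h1, h2⟩
      exact ⟨t, h p.1 h1, h p.2 h2⟩
    · intro h
      have := Convex.helly_theorem' (𝕜 := ℝ) (E := ℝ) (s := hK.toFinset)
        (F := fun k => {t : ℝ | signCond k.2 (α k.1 x + c k.1 * t)})
        (fun k _ => convex_signCond _ _ _) (by
          intro I hI hcard
          have hmem : ∀ k ∈ I, k ∈ K := fun k hk => by simpa using hI hk
          simp only [Module.finrank_self] at hcard
          rcases I.eq_empty_or_nonempty with rfl | ⟨k, hk⟩
          · simp
          have hc1 : (I.erase k).card ≤ 1 := by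
            rw [Finset.card_erase_of_mem hk]; omega
          rcases (I.erase k).eq_empty_or_nonempty with he | ⟨k', hk'⟩
          · obtain ⟨t, ht, -⟩ := h (k, k) ⟨hmem k hk, hmem k hk⟩
            refine ⟨t, ?_⟩
            simp only [Set.mem_iInter]
            intro i hi
            by_cases hik : i = k
            · subst hik; exact ht
            · exact absurd (Finset.mem_erase.2 ⟨hik, hi⟩) (by simp [he])
          · obtain ⟨t, ht, ht'⟩ := h (k, k')
              ⟨hmem k hk, hmem k' (Finset.mem_of_mem_erase hk')⟩
            refine ⟨t, ?_⟩
            simp only [Set.mem_iInter]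
            intro i hi
            by_cases hik : i = k
            · subst hik; exact ht
            · have : i = k' := Finset.card_le_one.1 hc1 _ (Finset.mem_erase.2 ⟨hik, hi⟩) _ hk'
              subst this; exact ht')
      obtain ⟨t, ht⟩ := this
      refine ⟨t, fun k hk => ?_⟩
      simp only [Set.mem_iInter] at ht
      exact ht k (hK.mem_toFinset.2 hk)
  rw [key]
  exact isBasicSemilinear_biInter (hK.prod hK) fun p _ => isBasicSemilinear_exists_pair _ _ _ _ _ _

theorem IsSemilinear.image_fst {S : Set (E × ℝ)} (hS : IsSemilinear S) :
    IsSemilinear (Prod.fst '' S) := by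
  obtain ⟨P, hP, hb, rfl⟩ := hS
  refine ⟨(fun T => Prod.fst '' T) '' P, hP.image _, ?_, ?_⟩
  · rintro _ ⟨T, hT, rfl⟩
    exact (hb T hT).image_fst
  · rw [Set.sUnion_image, Set.sUnion_eq_biUnion, Set.image_iUnion₂]

theorem IsSemilinear.image_fst_pi {n : ℕ} {S : Set (E × (Fin n → ℝ))} (hS : IsSemilinear S) :
    IsSemilinear (Prod.fst '' S) := by
  induction n with
  | zero =>
    convert hS.preimage (LinearMap.inl ℝ E (Fin 0 → ℝ)).toAffineMap using 1
    ext x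
    constructor
    · rintro ⟨⟨x, v⟩, h, rfl⟩
      have : v = 0 := Subsingleton.elim _ _
      subst this
      exact h
    · intro h
      exact ⟨(x, 0), h, rfl⟩
  | succ n ih =>
    let φ : ((E × (Fin n → ℝ)) × ℝ) →ₗ[ℝ] E × (Fin (n + 1) → ℝ) :=
      { toFun := fun p => (p.1.1, Fin.cons p.2 p.1.2)
        map_add' := fun p q => by
          refine Prod.ext rfl (funext fun i => ?_)
          refine Fin.cases ?_ (fun i => ?_) i <;> simp
        map_smul' := fun r p => by
          refine Prod.ext rfl (funext fun i => ?_)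
          refine Fin.cases ?_ (fun i => ?_) i <;> simp }
    convert ih (hS.preimage φ.toAffineMap).image_fst using 1
    ext x
    constructor
    · rintro ⟨⟨x, v⟩, h, rfl⟩
      refine ⟨(x, Fin.tail v), ⟨((x, Fin.tail v), v 0), ?_, rfl⟩, rfl⟩
      simpa [φ] using h
    · rintro ⟨_, ⟨q, h, rfl⟩, rfl⟩
      exact ⟨_, h, rfl⟩

/-- The image of a semi-linear set under an affine map is semi-linear. -/
theorem IsSemilinear.image {n m : ℕ} {S : Set (Fin n → ℝ)} (hS : IsSemilinear S)
    (g : (Fin n → ℝ) →ᵃ[ℝ] (Fin m → ℝ)) : IsSemilinear (g '' S) := by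
  let l : Fin m → ((Fin m → ℝ) × (Fin n → ℝ) →ᵃ[ℝ] ℝ) := fun j =>
    (LinearMap.proj j ∘ₗ LinearMap.fst ℝ _ _).toAffineMap -
      ((LinearMap.proj j).toAffineMap.comp g).comp (LinearMap.snd ℝ _ _).toAffineMap
  have h := ((hS.preimage (LinearMap.snd ℝ (Fin m → ℝ) (Fin n → ℝ)).toAffineMap).inter_basic
    (isBasicSemilinear_biInter (Set.finite_univ (α := Fin m))
      fun j _ => isBasicSemilinear_eqZero (l j))).image_fst_pi
  convert h using 1
  ext y
  constructor
  · rintro ⟨x, hx, rfl⟩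
    exact ⟨(g x, x), ⟨hx, by simp [l]⟩, rfl⟩
  · rintro ⟨⟨y, x⟩, ⟨hx, hy⟩, rfl⟩
    refine ⟨x, hx, funext fun j => ?_⟩
    simp only [Set.mem_iInter] at hy
    have := hy j (Set.mem_univ j)
    simp only [l, Set.mem_ofPred_eq] at this
    exact (sub_eq_zero.1 (by simpa using this)).symm

end Semilinear

/-! ### Diagrams and limit computations in a category -/

section Complexity

variable {C : Type*} [Category C] {D : Type*} [Category D]

/-- A diagram in `C`: a directed graph (vertices `V`, edges `E u v` from `u` to `v`; loops and
multiple edges are allowed) together with a graph homomorphism to the underlying graph of `C`.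
No commutativity is required. -/
structure Diagram (C : Type*) [Category C] where
  V : Type
  E : V → V → Type
  obj : V → C
  map : ∀ {u v : V}, E u v → (obj u ⟶ obj v)

namespace Diagram

/-- Finitely many vertices and edges. -/
def IsFinite (X : Diagram C) : Prop :=
  Finite X.V ∧ Finite (Σ p : X.V × X.V, X.E p.1 p.2)

/-- The number of edges (of a finite diagram). -/
noncomputable def edgeCount (X : Diagram C) : ℕ := Nat.card (Σ p : X.V × X.V, X.E p.1 p.2)

/-- The subdiagram on a set of vertices (with all edges between them). -/
def restrict (X : Diagram C) (J : Set X.V) : Diagram C where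
  V := J
  E u v := X.E u v
  obj v := X.obj v
  map e := X.map e

/-- The image of a diagram under a functor. -/
def mapFunctor (X : Diagram C) (F : C ⥤ D) : Diagram D where
  V := X.V
  E := X.E
  obj v := F.obj (X.obj v)
  map e := F.map (X.map e)

/-- The diagram with one vertex and no edges. -/
def single (A : C) : Diagram C where
  V := Unit
  E _ _ := Empty
  obj _ := A
  map e := e.elim

/-- Cones over a diagram. -/
structure Cone (X : Diagram C) where
  pt : C
  π : ∀ v, pt ⟶ X.obj v
  w : ∀ {u v : X.V} (e : X.E u v), π u ≫ X.map e = π v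

/-- Limit cones. -/
def Cone.IsLimit {X : Diagram C} (c : X.Cone) : Prop :=
  ∀ c' : X.Cone, ∃! m : c'.pt ⟶ c.pt, ∀ v, m ≫ c.π v = c'.π v

/-- The edges after adding a new vertex `none` with one edge to each vertex in `J`. -/
def ConeEdge (X : Diagram C) (J : Set X.V) : Option X.V → Option X.V → Type
  | some u, some v => X.E u v
  | none, some v => PLift (v ∈ J)
  | some _, none => Empty
  | none, none => Empty

/-- The objects after adding a new vertex `none` with object `A`. -/
def coneObj (X : Diagram C) (A : C) : Option X.V → C
  | some v => X.obj v
  | none => A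

/-- The diagram obtained from `X` by adding a cone `c` over the subdiagram on `J`: one new vertex
`none` carrying the vertex of the cone, and the edges of the cone. -/
def addCone (X : Diagram C) (J : Set X.V) (c : (X.restrict J).Cone) : Diagram C where
  V := Option X.V
  E := X.ConeEdge J
  obj := X.coneObj c.pt
  map {u v} e :=
    match u, v, e with
    | some _, some _, e => X.map e
    | none, some v, e => c.π ⟨v, e.down⟩

/-- If `gen v` is the set of vertices over which the limit `v` was taken, extend `gen` to the new
vertex of `addCone`. -/
def extendGen (X : Diagram C) (gen : X.V → Set X.V) (J : Set X.V) : Option X.V → Set (Option X.V)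
  | some v => some '' gen v
  | none => some '' J

/-- `X` is isomorphic to a (not necessarily full) subdiagram of `Y`. -/
def IsoSubdiagram (X Y : Diagram C) : Prop :=
  ∃ (a : X.V → Y.V) (b : ∀ u v : X.V, X.E u v → Y.E (a u) (a v))
    (φ : ∀ v, X.obj v ≅ Y.obj (a v)),
    Function.Injective a ∧ (∀ u v, Function.Injective (b u v)) ∧
      ∀ (u v : X.V) (e : X.E u v), X.map e ≫ (φ v).hom = (φ u).hom ≫ Y.map (b u v e)

end Diagram

open Diagram

/-- `LimitComputation 𝒜 X gen n`: there is a (constructive) limit computation `(D₀, …, D_s)` with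
basic morphisms `𝒜`, last diagram `D_s = X` and cost `n` (the number of edges of `D₀` plus the
number `s` of limits taken). Here `gen v ⊆ X.V` is the set of vertices over which the limit `v`
was taken (empty for the vertices `v` of `D₀`).
* `D₀` is a finite diagram consisting of basic morphisms: each edge is basic, and each vertex is
  the source or target of an edge.
* Each step adds a limit cone over the subdiagram on a set `J` of vertices. Constructivity: if `J`
  contains a vertex obtained as a limit over `J'`, then `J' ⊆ J`. -/
inductive LimitComputation (𝒜 : MorphismProperty C) :
    (X : Diagram C) → (X.V → Set X.V) → ℕ → Prop
  | init (X : Diagram C) (hfin : X.IsFinite)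
      (hbasic : ∀ (u v : X.V) (e : X.E u v), 𝒜 (X.map e))
      (hvert : ∀ v : X.V, ∃ u : X.V, Nonempty (X.E u v) ∨ Nonempty (X.E v u)) :
      LimitComputation 𝒜 X (fun _ => ∅) X.edgeCount
  | step (X : Diagram C) (gen : X.V → Set X.V) (n : ℕ) (h : LimitComputation 𝒜 X gen n)
      (J : Set X.V) (hJ : ∀ v ∈ J, gen v ⊆ J) (c : (X.restrict J).Cone) (hc : c.IsLimit) :
      LimitComputation 𝒜 (X.addCone J c) (X.extendGen gen J) (n + 1)

/-- The limit complexity of a diagram with respect to the basic morphisms `𝒜` (each of unit cost):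
the least cost of a limit computation that computes it, and `⊤` if there is none. -/
noncomputable def limitComplexity (𝒜 : MorphismProperty C) (X : Diagram C) : ℕ∞ :=
  sInf {N : ℕ∞ | ∃ (Y : Diagram C) (gen : Y.V → Set Y.V) (n : ℕ),
    LimitComputation 𝒜 Y gen n ∧ X.IsoSubdiagram Y ∧ N = n}

/-- The complexity of a functor with respect to complexity functions `φ`, `ψ`. -/
noncomputable def functorComplexity (φ : Diagram C → ℕ∞) (ψ : Diagram D → ℕ∞) (F : C ⥤ D)
    (n : ℕ) : ℕ∞ :=
  ⨆ (X : Diagram C) (_ : X.IsFinite) (_ : φ X ≤ n), ψ (X.mapFunctor F)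

/-- The same supremum restricted to the diagrams with a single vertex and no edges, that is, to
the objects of `C`. -/
noncomputable def functorObjComplexity (φ : Diagram C → ℕ∞) (ψ : Diagram D → ℕ∞) (F : C ⥤ D)
    (n : ℕ) : ℕ∞ :=
  ⨆ (A : C) (_ : φ (single A) ≤ n), ψ ((single A).mapFunctor F)

/-- Bounded by a polynomial. -/
def PolynomiallyBounded (f : ℕ → ℕ∞) : Prop :=
  ∃ p : Polynomial ℕ, ∀ n : ℕ, f n ≤ ((p.eval n : ℕ) : ℕ∞)

/-! ### The arrow category -/

/-- The edges of the diagram in `C` induced by a diagram in the arrow category: two copies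
(`false` for sources, `true` for targets) of each edge, and an edge from the first to the second
copy of each vertex. -/
def ArrowEdge (X : Diagram (Arrow C)) : X.V × Bool → X.V × Bool → Type
  | (u, false), (v, false) => X.E u v
  | (u, true), (v, true) => X.E u v
  | (u, false), (v, true) => PLift (u = v)
  | (_, true), (_, false) => Empty

/-- The objects of the diagram in `C` induced by a diagram in the arrow category. -/
def arrowObj (X : Diagram (Arrow C)) : X.V × Bool → C
  | (v, false) => (X.obj v).left
  | (v, true) => (X.obj v).right

/-- The diagram in `C` induced by a diagram in the arrow category of `C`. -/
def Diagram.ofArrow (X : Diagram (Arrow C)) : Diagram C where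
  V := X.V × Bool
  E := ArrowEdge X
  obj := arrowObj X
  map {u v} e :=
    match u, v, e with
    | (_, false), (_, false), e => (X.map e).left
    | (_, true), (_, true), e => (X.map e).right
    | (u, false), (_, true), ⟨h⟩ => (X.obj u).hom ≫ eqToHom (congrArg (fun w => (X.obj w).right) h)

/-- Monomorphisms, as objects of the arrow category. -/
def monoArrows (C : Type*) [Category C] : ObjectProperty (Arrow C) := fun f => Mono f.hom

/-- The category of monomorphisms of `C`: a full subcategory of the arrow category. -/
abbrev MonoArrow (C : Type*) [Category C] := (monoArrows C).FullSubcategory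

/-- The inclusion of the category of monomorphisms into the arrow category. -/
abbrev monoInclusion (C : Type*) [Category C] : MonoArrow C ⥤ Arrow C := (monoArrows C).ι

/-- Limit complexity of diagrams in the arrow category. -/
noncomputable def arrowLimitComplexity (𝒜 : MorphismProperty C) (X : Diagram (Arrow C)) : ℕ∞ :=
  limitComplexity 𝒜 X.ofArrow

/-- Limit complexity of diagrams in the category of monomorphisms. -/
noncomputable def monoLimitComplexity (𝒜 : MorphismProperty C) (X : Diagram (MonoArrow C)) : ℕ∞ :=
  arrowLimitComplexity 𝒜 (X.mapFunctor (monoInclusion C))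

end Complexity

/-! ### The category of semi-linear sets -/

/-- An embedded semi-linear set. -/
structure SL where
  dim : ℕ
  carrier : Set (Fin dim → ℝ)
  semilinear : IsSemilinear carrier

namespace SL

/-- Morphisms of semi-linear sets: restrictions of affine maps of the ambient spaces. -/
@[ext]
structure Hom (A B : SL) where
  toFun : A.carrier → B.carrier
  exists_affine : ∃ g : (Fin A.dim → ℝ) →ᵃ[ℝ] (Fin B.dim → ℝ),
    ∀ x : A.carrier, (toFun x : Fin B.dim → ℝ) = g x

instance : Category SL where
  Hom := Hom
  id A := ⟨id, AffineMap.id ℝ _, fun _ => rfl⟩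
  comp f g := ⟨g.toFun ∘ f.toFun, by
    obtain ⟨a, ha⟩ := f.exists_affine
    obtain ⟨b, hb⟩ := g.exists_affine
    exact ⟨b.comp a, fun x => by simp [ha, hb]⟩⟩

theorem hom_ext {A B : SL} {f g : A ⟶ B} (h : ∀ x, f.toFun x = g.toFun x) : f = g :=
  Hom.ext (funext h)

theorem comp_toFun {A B B' : SL} (f : A ⟶ B) (g : B ⟶ B') (x : A.carrier) :
    (f ≫ g).toFun x = g.toFun (f.toFun x) := rfl

/-- The restriction of an affine map. -/
def ofAffine {A B : SL} (g : (Fin A.dim → ℝ) →ᵃ[ℝ] (Fin B.dim → ℝ))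
    (h : ∀ x ∈ A.carrier, g x ∈ B.carrier) : A ⟶ B :=
  Hom.mk (fun x => ⟨g x, h x x.2⟩) ⟨g, fun _ => rfl⟩

/-- The space `ℝⁿ`. -/
abbrev space (n : ℕ) : SL := ⟨n, Set.univ, isBasicSemilinear_univ.isSemilinear⟩

/-- The half-line `[0, ∞)` in `ℝ`. -/
abbrev ray : SL := ⟨1, {x | 0 ≤ x 0},
  (isBasicSemilinear_nonneg
    (LinearMap.proj (R := ℝ) (φ := fun _ : Fin 1 => ℝ) 0).toAffineMap).isSemilinear⟩

/-- Multiplication by `c` on `ℝ`. -/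
def scalar (c : ℝ) : space 1 ⟶ space 1 :=
  ofAffine (c • LinearMap.id (R := ℝ) (M := Fin 1 → ℝ)).toAffineMap fun _ _ => trivial

/-- The addition `ℝ² → ℝ`. -/
def add : space 2 ⟶ space 1 :=
  ofAffine (LinearMap.pi (φ := fun _ : Fin 1 => ℝ) fun _ =>
    LinearMap.proj (R := ℝ) (φ := fun _ : Fin 2 => ℝ) 0 + LinearMap.proj 1).toAffineMap
    fun _ _ => trivial

/-- The inclusion of `[0, ∞)` into `ℝ`. -/
def rayInclusion : ray ⟶ space 1 :=
  ofAffine (AffineMap.id ℝ (Fin 1 → ℝ)) fun _ _ => trivial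

/-- The map `ℝ → 0` to the one-point space `0 = ℝ⁰`. -/
def toPoint : space 1 ⟶ space 0 :=
  ofAffine (0 : (Fin 1 → ℝ) →ₗ[ℝ] (Fin 0 → ℝ)).toAffineMap fun _ _ => trivial

/-- The two coordinate projections `ℝ² → ℝ`. -/
def proj (i : Fin 2) : space 2 ⟶ space 1 :=
  ofAffine (LinearMap.pi (φ := fun _ : Fin 1 => ℝ) fun _ =>
    LinearMap.proj (R := ℝ) (φ := fun _ : Fin 2 => ℝ) i).toAffineMap fun _ _ => trivial

/-- The constant `c`, as a morphism `0 → ℝ`. -/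
def const (c : ℝ) : space 0 ⟶ space 1 :=
  ofAffine (AffineMap.const ℝ (Fin 0 → ℝ) (fun _ : Fin 1 => c)) fun _ _ => trivial

/-- The basic morphisms: scalar multiplications, addition, `[0, ∞) → ℝ` and `ℝ → 0`. -/
inductive Basic : ∀ {A B : SL}, (A ⟶ B) → Prop
  | scalar (c : ℝ) : Basic (scalar c)
  | add : Basic add
  | rayInclusion : Basic rayInclusion
  | toPoint : Basic toPoint

/-- The coordinate projections, as a set of morphisms. -/
inductive Proj : ∀ {A B : SL}, (A ⟶ B) → Prop
  | proj (i : Fin 2) : Proj (proj i)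

/-- The constants, as a set of morphisms. -/
inductive Const : ∀ {A B : SL}, (A ⟶ B) → Prop
  | const (c : ℝ) : Const (const c)

/-- The set of basic morphisms: scalar multiplications, addition, `[0, ∞) → ℝ` and `ℝ → 0`. -/
def basic : MorphismProperty SL := fun _ _ f => Basic f

/-- The set consisting of the two coordinate projections `ℝ² → ℝ`. -/
def projections : MorphismProperty SL := fun _ _ f => Proj f

/-- The set of all constants `0 → ℝ`. -/
def constants : MorphismProperty SL := fun _ _ f => Const f

/-! ### The image functor

The image functor is the left adjoint of the inclusion of the monomorphisms into the arrow
category. For `f : A → B` it is constructed as the quotient of `A` by the subspace `V` spanned by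
the differences `x - y` with `f x = f y`; this quotient is realized as `q(A)` for a linear
projection `q` with kernel `V`. For convex `A` it is isomorphic to the set-theoretic image. -/

theorem mono_iff_injective {A B : SL} (f : A ⟶ B) : Mono f ↔ Function.Injective f.toFun := by
  constructor
  · intro hf x y hxy
    let pt : A.carrier → (space 0 ⟶ A) := fun a =>
      ofAffine (AffineMap.const ℝ (Fin 0 → ℝ) (a : Fin A.dim → ℝ)) fun _ _ => a.2
    have h : pt x = pt y := by
      rw [← cancel_mono f]
      refine hom_ext fun z => ?_
      exact hxy
    have := congrArg (fun k => (k : Hom (space 0) A).toFun ⟨0, trivial⟩) h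
    exact Subtype.ext (congrArg Subtype.val this)
  · intro hf
    refine ⟨fun g h hgh => hom_ext fun z => hf ?_⟩
    rw [← comp_toFun, ← comp_toFun, hgh]

/-- The span of all differences of pairs of points with the same value under `f`. -/
def kernelSpan {A B : SL} (f : A ⟶ B) : Submodule ℝ (Fin A.dim → ℝ) :=
  Submodule.span ℝ {d | ∃ x y : A.carrier, f.toFun x = f.toFun y ∧ d = x.1 - y.1}

theorem exists_projection {n : ℕ} (V : Submodule ℝ (Fin n → ℝ)) :
    ∃ q : (Fin n → ℝ) →ₗ[ℝ] (Fin n → ℝ), (∀ x ∈ V, q x = 0) ∧ ∀ x, x - q x ∈ V := by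
  obtain ⟨W, hW⟩ := Submodule.exists_isCompl V
  have hk := Submodule.ker_projection hW.symm
  refine ⟨W.projection V hW.symm, fun x hx => ?_, fun x => ?_⟩
  · rw [← LinearMap.mem_ker, hk]; exact hx
  · refine hk.le (LinearMap.mem_ker.2 ?_)
    rw [map_sub, sub_eq_zero]
    exact (LinearMap.congr_fun (Submodule.isIdempotentElem_projection hW.symm) x).symm

/-- A linear projection with kernel `kernelSpan f`. -/
noncomputable def quot {A B : SL} (f : A ⟶ B) : (Fin A.dim → ℝ) →ₗ[ℝ] (Fin A.dim → ℝ) :=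
  (exists_projection (kernelSpan f)).choose

theorem quot_eq {A B : SL} (f : A ⟶ B) {x y : A.carrier} (h : f.toFun x = f.toFun y) :
    quot f x = quot f y := by
  rw [← sub_eq_zero, ← map_sub]
  exact (exists_projection (kernelSpan f)).choose_spec.1 _ (Submodule.subset_span ⟨x, y, h, rfl⟩)

/-- An affine map that extends a morphism identifying all points that `f` identifies is invariant
under `quot f`. -/
theorem affine_quot {A B B' : SL} (f : A ⟶ B) (h : A ⟶ B')
    (hfh : ∀ x y, f.toFun x = f.toFun y → h.toFun x = h.toFun y)
    (g : (Fin A.dim → ℝ) →ᵃ[ℝ] (Fin B'.dim → ℝ)) (hg : ∀ x, (h.toFun x : Fin B'.dim → ℝ) = g x)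
    (x : Fin A.dim → ℝ) : g (quot f x) = g x := by
  have hV : kernelSpan f ≤ LinearMap.ker g.linear := by
    refine Submodule.span_le.2 ?_
    rintro _ ⟨x, y, hxy, rfl⟩
    have h1 := AffineMap.linearMap_vsub g x.1 y.1
    rw [vsub_eq_sub, vsub_eq_sub, ← hg, ← hg, hfh x y hxy, sub_self] at h1
    exact h1
  have h1 := hV ((exists_projection (kernelSpan f)).choose_spec.2 x)
  have h2 := AffineMap.linearMap_vsub g x (quot f x)
  rw [vsub_eq_sub, vsub_eq_sub] at h2
  rw [LinearMap.mem_ker] at h1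
  exact (sub_eq_zero.1 (h2.symm.trans h1)).symm

/-- The quotient of `A` through which `f : A ⟶ B` factors. -/
noncomputable abbrev coim {A B : SL} (f : A ⟶ B) : SL :=
  ⟨A.dim, (quot f).toAffineMap '' A.carrier, A.semilinear.image _⟩

/-- The canonical map from `A` to the image of `f : A ⟶ B`. -/
noncomputable def toCoim {A B : SL} (f : A ⟶ B) : A ⟶ coim f :=
  ofAffine (B := coim f) (quot f).toAffineMap fun x hx => ⟨x, hx, rfl⟩

theorem toCoim_surjective {A B : SL} (f : A ⟶ B) : Function.Surjective (toCoim f).toFun := by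
  rintro ⟨_, x, hx, rfl⟩
  exact ⟨⟨x, hx⟩, rfl⟩

theorem exists_desc {A B B' : SL} (f : A ⟶ B) (h : A ⟶ B')
    (hfh : ∀ x y, f.toFun x = f.toFun y → h.toFun x = h.toFun y) :
    ∃ k : coim f ⟶ B', toCoim f ≫ k = h := by
  obtain ⟨g, hg⟩ := h.exists_affine
  have hq := affine_quot f h hfh g hg
  refine ⟨ofAffine (A := coim f) g ?_, hom_ext fun x => Subtype.ext ?_⟩
  · rintro _ ⟨x, hx, rfl⟩
    have : g ((quot f).toAffineMap x) = (h.toFun ⟨x, hx⟩).1 := (hq x).trans (hg ⟨x, hx⟩).symm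
    exact this ▸ (h.toFun ⟨x, hx⟩).2
  · exact (hq x.1).trans (hg x).symm

/-- The image of `f : A ⟶ B`, as a morphism to `B`. -/
noncomputable def imageMap {A B : SL} (f : A ⟶ B) : coim f ⟶ B :=
  (exists_desc f f fun _ _ h => h).choose

theorem toCoim_imageMap {A B : SL} (f : A ⟶ B) : toCoim f ≫ imageMap f = f :=
  (exists_desc f f fun _ _ h => h).choose_spec

theorem imageMap_mono {A B : SL} (f : A ⟶ B) : Mono (imageMap f) := by
  rw [mono_iff_injective]
  intro y y' h
  obtain ⟨x, rfl⟩ := toCoim_surjective f y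
  obtain ⟨x', rfl⟩ := toCoim_surjective f y'
  rw [← comp_toFun, ← comp_toFun, toCoim_imageMap] at h
  exact Subtype.ext (quot_eq f h)

/-- The image of an arrow, as an object of the category of monomorphisms. -/
noncomputable def imageObj (X : Arrow SL) : MonoArrow SL :=
  ⟨Arrow.mk (imageMap X.hom), imageMap_mono X.hom⟩

/-- The unit of the adjunction. -/
noncomputable def imageUnit (X : Arrow SL) : X ⟶ (imageObj X).obj :=
  Arrow.homMk (toCoim X.hom) (𝟙 _) (by simp [imageObj, toCoim_imageMap])

theorem imageUnit_bijective (X : Arrow SL) (Y : MonoArrow SL) :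
    Function.Bijective fun k : imageObj X ⟶ Y => imageUnit X ≫ (monoInclusion SL).map k := by
  constructor
  · intro k k' h
    have hl := congrArg CommaMorphism.left h
    have hr := congrArg CommaMorphism.right h
    apply ObjectProperty.hom_ext
    refine Arrow.hom_ext _ _ ?_ ?_
    · refine hom_ext fun y => ?_
      obtain ⟨x, rfl⟩ := toCoim_surjective X.hom y
      exact congrArg (fun m => (m : Hom _ _).toFun x) hl
    · exact (Category.id_comp (X := X.right) _).symm.trans
        (hr.trans (Category.id_comp (X := X.right) _))
  · intro h
    have hY : Function.Injective Y.obj.hom.toFun := (mono_iff_injective _).1 Y.property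
    obtain ⟨k, hk⟩ := exists_desc X.hom h.left fun x y hxy => hY (by
      have hw : h.left ≫ Y.obj.hom = X.hom ≫ h.right := Arrow.w h
      rw [← comp_toFun, ← comp_toFun, hw, comp_toFun, comp_toFun]
      exact congrArg _ hxy)
    refine ⟨ObjectProperty.homMk (Arrow.homMk k h.right ?_), ?_⟩
    · refine hom_ext fun y => ?_
      obtain ⟨x, rfl⟩ := toCoim_surjective X.hom y
      have h1 : toCoim X.hom ≫ k ≫ Y.obj.hom = toCoim X.hom ≫ imageMap X.hom ≫ h.right := by
        rw [← Category.assoc, hk, ← Category.assoc, toCoim_imageMap]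
        exact Arrow.w h
      exact congrArg (fun m => (m : Hom _ _).toFun x) h1
    · refine Arrow.hom_ext _ _ ?_ ?_
      · exact hk
      · exact Category.id_comp (X := X.right) h.right

/-- The image functor of `SL`. -/
noncomputable def im : Arrow SL ⥤ MonoArrow SL :=
  Adjunction.leftAdjointOfEquiv (G := monoInclusion SL)
    (fun X Y => Equiv.ofBijective _ (imageUnit_bijective X Y)) (by simp)

/-- The image functor is left adjoint to the inclusion of the category of monomorphisms into the
arrow category. -/
noncomputable def imAdjunction : im ⊣ monoInclusion SL :=
  Adjunction.adjunctionOfEquivLeft _ _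

end SL

end CategoricalComplexity

open CategoricalComplexity

namespace CategoricalComplexity

open Diagram

/-! For the first claim one diagram suffices: the zero map `ℝ → ℝ` with an identity loop. Its image
has a loop at a one-point set. A limit step never creates a loop, and a basic morphism that is a
loop lives on a set with at least two points, so no computation produces this image and a single
value of the complexity function is already infinite (`monoLimitComplexity_zeroLoop`).

For single morphisms the obstruction is a facet count, phrased so that it makes sense for every
semi-linear set and is invariant under isomorphism. The reflection of `a` in `b` is `2b - a`. Facets
are counted by bad pairs `(a, b)`: their reflections leave the set, while the midpoint of the
reflections of any two distinct pairs stays in it (`ReflectionBound`). A half-line or a space `ℝ^m`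
admits at most one bad pair. A limit contains a reflection as soon as the initial vertices among
those it is taken over contain its images (`hasReflection_of_isLimit`, `exists_initial_vertices`);
here constructivity enters. Hence each bad pair of a limit is detected at an initial vertex,
distinct pairs at distinct vertices, and a computation of cost `N` has at most `2 * N` initial
vertices.

On the other side, `coneMap n` is computed at cost at most `8 * n + 3`, and its image is the cone `∑
max (x i) 0 ≤ t`, that is, `∑ i ∈ S, x i ≤ t` for all `S ⊆ Fin n`. Every `S` gives a facet and a bad
pair (`not_hasReflection_facetPoint`, `hasMidReflection_facetPoint`), so computing the image costs
at least `2 ^ n / 2`. -/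

/-- A diagram is isomorphic to a subdiagram of itself. -/
theorem Diagram.isoSubdiagram_refl {C : Type*} [Category C] (X : Diagram C) :
    X.IsoSubdiagram X :=
  ⟨id, fun _ _ => id, fun _ => Iso.refl _, Function.injective_id,
    fun _ _ => Function.injective_id, fun _ _ _ => by simp⟩

namespace SL

/-! ### Reflections of points -/

theorem exists_linear {A B : SL} (f : A ⟶ B) :
    ∃ (L : (Fin A.dim → ℝ) →ₗ[ℝ] (Fin B.dim → ℝ)) (v : Fin B.dim → ℝ),
      ∀ x, (f.toFun x).1 = L x.1 + v := by
  obtain ⟨g, hg⟩ := f.exists_affine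
  exact ⟨g.linear, g 0, fun x => (hg x).trans (congrFun g.decomp x.1)⟩

/-- The reflection of `a` in `b` belongs to `A`. -/
def HasReflection {A : SL} (a b : A.carrier) : Prop :=
  ∃ d : A.carrier, d.1 + a.1 = b.1 + b.1

/-- The midpoint of the reflections of `a` in `b` and of `a'` in `b'` belongs to `A`. -/
def HasMidReflection {A : SL} (a b a' b' : A.carrier) : Prop :=
  ∃ c : A.carrier, c.1 + c.1 + (a.1 + a'.1) = b.1 + b.1 + (b'.1 + b'.1)

theorem map_reflection {A B : SL} (f : A ⟶ B) {d a b : A.carrier}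
    (h : d.1 + a.1 = b.1 + b.1) :
    (f.toFun d).1 + (f.toFun a).1 = (f.toFun b).1 + (f.toFun b).1 := by
  obtain ⟨L, v, hL⟩ := exists_linear f
  have := congrArg L h
  simp only [map_add] at this
  simp only [hL]
  linear_combination (exp := 1) this

theorem HasReflection.map {A B : SL} (f : A ⟶ B) {a b : A.carrier} (h : HasReflection a b) :
    HasReflection (f.toFun a) (f.toFun b) :=
  let ⟨d, hd⟩ := h
  ⟨f.toFun d, map_reflection f hd⟩

theorem HasMidReflection.map {A B : SL} (f : A ⟶ B) {a b a' b' : A.carrier}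
    (h : HasMidReflection a b a' b') :
    HasMidReflection (f.toFun a) (f.toFun b) (f.toFun a') (f.toFun b') := by
  obtain ⟨c, hc⟩ := h
  obtain ⟨L, v, hL⟩ := exists_linear f
  have := congrArg L hc
  simp only [map_add] at this
  refine ⟨f.toFun c, ?_⟩
  simp only [hL]
  linear_combination (exp := 1) this

theorem iso_hom_inv_apply {A B : SL} (φ : A ≅ B) (x : A.carrier) :
    φ.inv.toFun (φ.hom.toFun x) = x := by
  rw [← comp_toFun, φ.hom_inv_id]
  rfl

theorem hasReflection_iso {A B : SL} (φ : A ≅ B) {a b : A.carrier}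
    (h : HasReflection (φ.hom.toFun a) (φ.hom.toFun b)) : HasReflection a b := by
  simpa only [iso_hom_inv_apply] using h.map φ.inv

/-- At most `k` of the pairs in a family can miss their reflections, if all the midpoints of the
reflections are present. For a polyhedron, this holds if `k` is the number of facets. -/
def ReflectionBound (A : SL) (k : ℕ) : Prop :=
  ∀ (ι : Type) [Finite ι] (a b : ι → A.carrier),
    (∀ i j, i ≠ j → HasMidReflection (a i) (b i) (a j) (b j)) →
    (∀ i, ¬ HasReflection (a i) (b i)) → Nat.card ι ≤ k

/-- A computation determines its objects only up to isomorphism, so the count has to be invariant: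
affine maps carry midpoints of reflections forward, and the inverse carries reflections back. -/
theorem ReflectionBound.of_iso {A B : SL} {k : ℕ} (h : ReflectionBound B k) (φ : A ≅ B) :
    ReflectionBound A k := fun ι _ a b hm hr =>
  h ι (fun i => φ.hom.toFun (a i)) (fun i => φ.hom.toFun (b i)) (fun i j hij => (hm i j hij).map _)
    fun i hi => hr i (hasReflection_iso φ hi)

/-- Of two reflections with a midpoint in `A`, one belongs to `A`. -/
def IsHalfspaceLike (A : SL) : Prop :=
  ∀ a b a' b' : A.carrier, HasMidReflection a b a' b' → HasReflection a b ∨ HasReflection a' b'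

theorem isHalfspaceLike_space (n : ℕ) : IsHalfspaceLike (space n) := fun a b _ _ _ =>
  .inl ⟨⟨b.1 + b.1 - a.1, trivial⟩, sub_add_cancel _ _⟩

/-- The two reflections add up to twice their midpoint, which is nonnegative, so they are not both
negative. -/
theorem isHalfspaceLike_ray : IsHalfspaceLike ray := by
  rintro a b a' b' ⟨c, hc⟩
  have h0 := congrFun hc 0
  simp only [Pi.add_apply] at h0
  have hc0 : 0 ≤ c.1 0 := c.2
  rcases le_total 0 (b.1 0 + b.1 0 - a.1 0) with h | h
  · exact .inl ⟨⟨b.1 + b.1 - a.1, h⟩, sub_add_cancel _ _⟩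
  · refine .inr ⟨⟨b'.1 + b'.1 - a'.1, ?_⟩, sub_add_cancel _ _⟩
    change 0 ≤ b'.1 0 + b'.1 0 - a'.1 0
    linarith

theorem isHalfspaceLike_of_basic {A B : SL} (f : A ⟶ B)
    (hf : (basic ⊔ projections ⊔ constants) f) : IsHalfspaceLike A ∧ IsHalfspaceLike B := by
  rcases hf with (hf | hf) | hf
  · cases hf
    · exact ⟨isHalfspaceLike_space 1, isHalfspaceLike_space 1⟩
    · exact ⟨isHalfspaceLike_space 2, isHalfspaceLike_space 1⟩
    · exact ⟨isHalfspaceLike_ray, isHalfspaceLike_space 1⟩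
    · exact ⟨isHalfspaceLike_space 1, isHalfspaceLike_space 0⟩
  · cases hf
    exact ⟨isHalfspaceLike_space 2, isHalfspaceLike_space 1⟩
  · cases hf
    exact ⟨isHalfspaceLike_space 0, isHalfspaceLike_space 1⟩

/-! ### Limits and points -/

/-- A point, as a morphism. -/
def point {A : SL} (a : A.carrier) : space 0 ⟶ A :=
  ofAffine (AffineMap.const ℝ (Fin 0 → ℝ) a.1) fun _ _ => a.2

/-- Points are morphisms from `ℝ⁰`, so the uniqueness part of the universal property separates them.
-/
theorem eq_of_isLimit {X : Diagram SL} {c : X.Cone} (hc : c.IsLimit) {x y : c.pt.carrier}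
    (h : ∀ v, (c.π v).toFun x = (c.π v).toFun y) : x = y := by
  let c' : X.Cone :=
    { pt := space 0
      π := fun v => point x ≫ c.π v
      w := fun e => by rw [Category.assoc, c.w] }
  have := (hc c').unique (y₁ := point x) (y₂ := point y) (fun v => rfl)
    fun v => hom_ext fun _ => (h v).symm
  exact congrArg (fun m : Hom (space 0) c.pt => m.toFun ⟨0, trivial⟩) this

theorem isSemilinear_threePoints :
    IsSemilinear {x : Fin 1 → ℝ | x 0 = 0 ∨ x 0 = 1 ∨ x 0 = 2} := by
  let l : ℝ → ((Fin 1 → ℝ) →ᵃ[ℝ] ℝ) := fun r =>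
    (LinearMap.proj (R := ℝ) (φ := fun _ : Fin 1 => ℝ) 0).toAffineMap - AffineMap.const ℝ _ r
  refine ⟨(fun r => {x | l r x = 0}) '' {0, 1, 2}, Set.Finite.image _ (by simp), ?_, ?_⟩
  · rintro _ ⟨r, -, rfl⟩
    exact isBasicSemilinear_eqZero _
  · ext x
    simp [l, sub_eq_zero]

/-- The set `{0, 1, 2}` in `ℝ`. -/
abbrev threePoints : SL := ⟨1, {x | x 0 = 0 ∨ x 0 = 1 ∨ x 0 = 2}, isSemilinear_threePoints⟩

/-- The morphism from `{0, 1, 2}` to `A` with values `a`, `b` and the reflection of `a` in `b`. -/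
def ofReflection {A : SL} {a b d : A.carrier} (h : d.1 + a.1 = b.1 + b.1) : threePoints ⟶ A :=
  ofAffine ((AffineMap.lineMap (k := ℝ) a.1 b.1).comp
    (LinearMap.proj (R := ℝ) (φ := fun _ : Fin 1 => ℝ) 0).toAffineMap) <| by
      rintro x (hx | hx | hx)
      · simp [hx]
      · simp [hx]
      · convert d.2 using 1
        simp only [AffineMap.comp_apply, LinearMap.coe_toAffineMap, LinearMap.proj_apply, hx,
          AffineMap.lineMap_apply, vsub_eq_sub, vadd_eq_add, two_smul]
        linear_combination (exp := 1) -h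

theorem ofReflection_apply {A : SL} {a b d : A.carrier} (h : d.1 + a.1 = b.1 + b.1)
    (x : threePoints.carrier) :
    ((ofReflection h).toFun x).1 = a.1 + x.1 0 • (b.1 - a.1) := by
  change AffineMap.lineMap (k := ℝ) a.1 b.1 (x.1 0) = _
  rw [AffineMap.lineMap_apply, vsub_eq_sub, vadd_eq_add, add_comm]

/-- The reflections in the legs are determined by `a` and `b`, hence compatible. A cone with a
one-point vertex would give a point of the limit, but not its affine relation to `a` and `b`,
because legs that separate points of a limit need not separate points of its ambient space. A cone
with vertex `{0, 1, 2}` carries the relation along, since the induced morphism is affine. -/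
theorem hasReflection_of_isLimit {X : Diagram SL} {c : X.Cone} (hc : c.IsLimit)
    {a b : c.pt.carrier} (h : ∀ v, HasReflection ((c.π v).toFun a) ((c.π v).toFun b)) :
    HasReflection a b := by
  choose d hd using h
  let c' : X.Cone :=
    { pt := threePoints
      π := fun v => ofReflection (hd v)
      w := by
        intro u v e
        refine hom_ext fun x => Subtype.ext ?_
        obtain ⟨L, t, hL⟩ := exists_linear (X.map e)
        have hw : ∀ y, ((X.map e).toFun ((c.π u).toFun y)) = (c.π v).toFun y := fun y => by
          rw [← comp_toFun, c.w]
        rw [comp_toFun, hL, ofReflection_apply, ofReflection_apply, ← hw a, ← hw b, hL, hL]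
        simp only [map_add, map_smul, map_sub]
        module }
  obtain ⟨m, hm, -⟩ := hc c'
  have hm' : ∀ v x, ((c.π v).toFun (m.toFun x)) = (ofReflection (hd v)).toFun x := fun v x => by
    rw [← comp_toFun, hm]
  -- At `0` and `1` the induced morphism has the same legs as `a` and `b`; its value at `2` is then
  -- the reflection sought.
  have h0 : m.toFun ⟨fun _ => 0, .inl rfl⟩ = a := eq_of_isLimit hc fun v => by
    rw [hm']; exact Subtype.ext (by rw [ofReflection_apply]; simp)
  have h1 : m.toFun ⟨fun _ => 1, .inr (.inl rfl)⟩ = b := eq_of_isLimit hc fun v => by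
    rw [hm']; exact Subtype.ext (by rw [ofReflection_apply]; simp)
  refine ⟨m.toFun ⟨fun _ => 2, .inr (.inr rfl)⟩, ?_⟩
  rw [← h0, ← h1]
  refine map_reflection m ?_
  ext i
  simp only [Pi.add_apply]
  norm_num

/-! ### The lower bound -/

/-- The set `R` consists of the vertices of the initial diagram. The invariant asks for edges `l`,
not just morphisms, because a later cone is compatible only with edges of the diagram. -/
theorem exists_initial_vertices {𝒜 : MorphismProperty SL}
    (h𝒜 : 𝒜 ≤ basic ⊔ projections ⊔ constants) {Y : Diagram SL} {gen : Y.V → Set Y.V} {N : ℕ}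
    (h : LimitComputation 𝒜 Y gen N) :
    ∃ R : Set Y.V, R.Finite ∧ R.ncard ≤ 2 * N ∧ (∀ r ∈ R, IsHalfspaceLike (Y.obj r)) ∧
      ∀ v, v ∈ R ∨ ∃ l : ∀ r ∈ R, r ∈ gen v → Y.E v r,
        ∀ a b : (Y.obj v).carrier,
          (∀ r hr hg, HasReflection ((Y.map (l r hr hg)).toFun a) ((Y.map (l r hr hg)).toFun b)) →
          HasReflection a b := by
  induction h with
  | init X hfin hbasic hvert =>
    obtain ⟨hV, hE⟩ := hfin
    refine ⟨Set.univ, Set.finite_univ, ?_, ?_, fun v => .inl trivial⟩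
    · let g : (Σ p : X.V × X.V, X.E p.1 p.2) × Bool → X.V := fun e => cond e.2 e.1.1.1 e.1.1.2
      have hg : Function.Surjective g := by
        intro v
        obtain ⟨u, ⟨⟨e⟩⟩ | ⟨⟨e⟩⟩⟩ := hvert v
        · exact ⟨(⟨(u, v), e⟩, false), rfl⟩
        · exact ⟨(⟨(v, u), e⟩, true), rfl⟩
      have := Nat.card_le_card_of_surjective g hg
      rw [Nat.card_prod, Nat.card_eq_fintype_card (α := Bool), Fintype.card_bool, mul_comm] at this
      rwa [Set.ncard_univ]
    · intro v _
      obtain ⟨u, ⟨⟨e⟩⟩ | ⟨⟨e⟩⟩⟩ := hvert v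
      · exact (isHalfspaceLike_of_basic _ (h𝒜 _ (hbasic _ _ e))).2
      · exact (isHalfspaceLike_of_basic _ (h𝒜 _ (hbasic _ _ e))).1
  | step X gen n h J hJ c hc ih =>
    obtain ⟨R, hfin, hcard, hR, hv⟩ := ih
    refine ⟨some '' R, hfin.image _, ?_, ?_, ?_⟩
    · exact (Set.ncard_image_le hfin).trans (hcard.trans (by omega))
    · rintro _ ⟨r, hr, rfl⟩
      exact hR r hr
    · have some_mem : ∀ {T : Set X.V} {r : X.V}, some r ∈ some '' T → r ∈ T := by
        rintro T r ⟨x, hx, h⟩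
        exact Option.some.inj h ▸ hx
      have none_notMem : ¬ (none : Option X.V) ∈ some '' R := by simp
      rintro (_ | v)
      · refine .inr ⟨fun r => match r with
          | some r => fun _ hg => ⟨some_mem hg⟩
          | none => fun hr _ => (none_notMem hr).elim, fun a b hab => ?_⟩
        refine hasReflection_of_isLimit hc fun ⟨v, hvJ⟩ => ?_
        rcases hv v with hvR | ⟨l, hl⟩
        · exact hab (some v) ⟨v, hvR, rfl⟩ ⟨v, hvJ, rfl⟩
        · refine hl _ _ fun r hr hg => ?_
          -- Constructivity: the initial vertices used by `v` lie in `J`, so the new cone has a leg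
          -- to `r`, and it factors through the leg to `v`.
          have hrJ : r ∈ J := hJ v hvJ hg
          have hw := c.w (u := ⟨v, hvJ⟩) (v := ⟨r, hrJ⟩) (l r hr hg)
          have hr' : HasReflection ((c.π ⟨r, hrJ⟩).toFun a) ((c.π ⟨r, hrJ⟩).toFun b) :=
            hab (some r) ⟨r, hr, rfl⟩ ⟨r, hrJ, rfl⟩
          rw [← hw] at hr'
          exact hr'
      · rcases hv v with hvR | ⟨l, hl⟩
        · exact .inl ⟨v, hvR, rfl⟩
        · refine .inr ⟨fun r => match r with
            | some r => fun hr hg => l r (some_mem hr) (some_mem hg)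
            | none => fun hr _ => (none_notMem hr).elim, fun a b hab => ?_⟩
          exact hl a b fun r hr hg => hab (some r) ⟨r, hr, rfl⟩ ⟨r, hg, rfl⟩

/-- Pigeonhole: assign to each bad pair an initial vertex at which the reflection is missing. Two
pairs with the same vertex would contradict that this vertex is half-space-like, since their
midpoint is mapped there as well. -/
theorem reflectionBound_of_limitComputation {𝒜 : MorphismProperty SL}
    (h𝒜 : 𝒜 ≤ basic ⊔ projections ⊔ constants) {Y : Diagram SL} {gen : Y.V → Set Y.V} {N : ℕ}
    (h : LimitComputation 𝒜 Y gen N) (v : Y.V) : ReflectionBound (Y.obj v) (2 * N) := by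
  obtain ⟨R, hfin, hcard, hR, hv⟩ := exists_initial_vertices h𝒜 h
  intro ι _ a b hm hr
  refine le_trans ?_ hcard
  have : Finite R := hfin
  suffices ∃ g : ι → R, Function.Injective g from
    let ⟨g, hg⟩ := this
    Nat.card_le_card_of_injective g hg
  rcases hv v with hvR | ⟨l, hl⟩
  -- At an initial vertex there is at most one bad pair, so a constant map is injective.
  · refine ⟨fun _ => ⟨v, hvR⟩, fun i j _ => ?_⟩
    by_contra hij
    exact (hR v hvR _ _ _ _ (hm i j hij)).elim (hr i) (hr j)
  · have : ∀ i, ∃ r : R, ∃ hg : r.1 ∈ gen v, ¬ HasReflection ((Y.map (l r r.2 hg)).toFun (a i))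
        ((Y.map (l r r.2 hg)).toFun (b i)) := by
      intro i
      by_contra! hcon
      exact hr i (hl _ _ fun r hr hg => hcon ⟨r, hr⟩ hg)
    choose g hg using this
    refine ⟨g, fun i j hgij => ?_⟩
    by_contra hij
    obtain ⟨hgi, hi⟩ := hg i
    obtain ⟨hgj, hj⟩ := hgij ▸ hg j
    exact (hR _ (g i).2 _ _ _ _ ((hm i j hij).map (Y.map (l (g i) (g i).2 hgi)))).elim hi hj

/-! ### Loops -/

/-- Only sources are controlled, since `ℝ → 0` has a one-point target; for a loop, source and target
coincide. -/
theorem nontrivial_of_basic {A B : SL} (f : A ⟶ B) (hf : basic f) : Nontrivial A.carrier := by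
  cases hf
  · exact ⟨⟨fun _ => 0, trivial⟩, ⟨fun _ => 1, trivial⟩, fun h => by
      simpa using congrFun (congrArg Subtype.val h) (0 : Fin 1)⟩
  · exact ⟨⟨fun _ => 0, trivial⟩, ⟨fun _ => 1, trivial⟩, fun h => by
      simpa using congrFun (congrArg Subtype.val h) (0 : Fin 2)⟩
  · exact ⟨⟨fun _ => 0, le_refl (0 : ℝ)⟩, ⟨fun _ => 1, zero_le_one (α := ℝ)⟩, fun h => by
      simpa using congrFun (congrArg Subtype.val h) (0 : Fin 1)⟩
  · exact ⟨⟨fun _ => 0, trivial⟩, ⟨fun _ => 1, trivial⟩, fun h => by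
      simpa using congrFun (congrArg Subtype.val h) (0 : Fin 1)⟩

/-- The new vertices of a limit computation carry no loops. -/
theorem nontrivial_of_loop {Y : Diagram SL} {gen : Y.V → Set Y.V} {N : ℕ}
    (h : LimitComputation basic Y gen N) (v : Y.V) (e : Y.E v v) :
    Nontrivial (Y.obj v).carrier := by
  induction h with
  | init X hfin hbasic hvert => exact nontrivial_of_basic _ (hbasic _ _ e)
  | step X gen n h J hJ c hc ih =>
    cases v with
    | none => exact e.elim
    | some v => exact ih v e

/-- The zero map `ℝ → ℝ` with an endomorphism. -/
def zeroLoop : Diagram (Arrow SL) where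
  V := Unit
  E _ _ := Unit
  obj _ := Arrow.mk (scalar 0)
  map _ := Arrow.homMk (scalar 1) (scalar 1)
    (hom_ext fun x => Subtype.ext (by simp [comp_toFun, scalar, ofAffine]))

theorem zeroLoop_basic (u v : zeroLoop.V × Bool) (e : zeroLoop.ofArrow.E u v) :
    basic (zeroLoop.ofArrow.map e) := by
  obtain ⟨u, _ | _⟩ := u <;> obtain ⟨v, _ | _⟩ := v
  · exact Basic.scalar 1
  · exact Basic.scalar 0
  · exact e.elim
  · exact Basic.scalar 1

theorem zeroLoop_ofArrow_isFinite : zeroLoop.ofArrow.IsFinite := by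
  have hE : ∀ u v : Unit × Bool, Finite (zeroLoop.ofArrow.E u v) := by
    rintro ⟨u, _ | _⟩ ⟨v, _ | _⟩
    · exact inferInstanceAs (Finite Unit)
    · exact inferInstanceAs (Finite (PLift (u = v)))
    · exact inferInstanceAs (Finite Empty)
    · exact inferInstanceAs (Finite Unit)
  have hV : Finite zeroLoop.ofArrow.V := inferInstanceAs (Finite (Unit × Bool))
  have hE' : ∀ p : zeroLoop.ofArrow.V × zeroLoop.ofArrow.V,
    Finite (zeroLoop.ofArrow.E p.1 p.2) := fun p => hE p.1 p.2
  exact ⟨hV, inferInstance⟩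

theorem zeroLoop_isFinite : zeroLoop.IsFinite :=
  ⟨inferInstanceAs (Finite Unit), inferInstanceAs (Finite (Σ _ : Unit × Unit, Unit))⟩

theorem arrowLimitComplexity_zeroLoop :
    arrowLimitComplexity basic zeroLoop ≤ zeroLoop.ofArrow.edgeCount := by
  refine sInf_le ⟨_, _, _, .init zeroLoop.ofArrow zeroLoop_ofArrow_isFinite zeroLoop_basic ?_,
    isoSubdiagram_refl _, rfl⟩
  rintro ⟨v, _ | _⟩
  · exact ⟨(v, false), .inl ⟨()⟩⟩
  · exact ⟨(v, true), .inl ⟨()⟩⟩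

/-- The image of `zeroLoop` contains a loop at a one-point set, so no limit computation
computes it. -/
theorem monoLimitComplexity_zeroLoop :
    monoLimitComplexity basic (zeroLoop.mapFunctor im) = ⊤ := by
  refine sInf_eq_top.2 ?_
  rintro _ ⟨Y, gen, n, hY, ⟨a, b, φ, -⟩, rfl⟩
  exfalso
  obtain ⟨x, y, hxy⟩ := nontrivial_of_loop hY (a ((), false)) (b ((), false) ((), false) ())
  let ψ : coim (scalar 0) ≅ Y.obj (a ((), false)) := φ ((), false)
  -- The zero map identifies all points, so the quotient collapses to one point.
  have hsub : ∀ p q : (coim (scalar 0)).carrier, p = q := by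
    intro p q
    obtain ⟨p, rfl⟩ := toCoim_surjective _ p
    obtain ⟨q, rfl⟩ := toCoim_surjective _ q
    refine Subtype.ext (quot_eq (scalar 0) (Subtype.ext ?_))
    simp [scalar, ofAffine]
  refine hxy ?_
  rw [← iso_hom_inv_apply ψ.symm x, ← iso_hom_inv_apply ψ.symm y]
  exact congrArg ψ.hom.toFun (hsub _ _)

/-- No growth is involved: the value at the edge count of `zeroLoop.ofArrow` is already `⊤`. -/
theorem not_polynomiallyBounded_im :
    ¬ PolynomiallyBounded
      (functorComplexity (arrowLimitComplexity basic) (monoLimitComplexity basic) im) := by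
  rintro ⟨p, hp⟩
  have h := hp zeroLoop.ofArrow.edgeCount
  have h' := le_iSup_of_le zeroLoop (le_iSup_of_le zeroLoop_isFinite
    (le_iSup_of_le arrowLimitComplexity_zeroLoop (monoLimitComplexity_zeroLoop.ge)))
    |>.trans h
  exact absurd h' (by simp)

/-! ### A polyhedral cone with few facets whose image has many -/

/-- A cone is a limit cone if the coordinates of its vertex are affine functions of the legs and
each compatible family of points comes from a point of the vertex. -/
theorem isLimit_of_coordinates {X : Diagram SL} {c : X.Cone}
    (hl : ∀ k : Fin c.pt.dim, ∃ (v : X.V) (l : (Fin (X.obj v).dim → ℝ) →ᵃ[ℝ] ℝ),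
      ∀ p : c.pt.carrier, p.1 k = l ((c.π v).toFun p).1)
    (hex : ∀ x : ∀ v, (X.obj v).carrier,
      (∀ (u v : X.V) (e : X.E u v), (X.map e).toFun (x u) = x v) →
        ∃ p : c.pt.carrier, ∀ v, (c.π v).toFun p = x v) : c.IsLimit := by
  choose v l hl using hl
  intro c'
  have hm : ∀ q : c'.pt.carrier, ∃ p : c.pt.carrier, ∀ v, (c.π v).toFun p = (c'.π v).toFun q :=
    fun q => hex _ fun u v e => by rw [← comp_toFun, c'.w]
  choose m hm using hm
  choose g hg using fun k => (c'.π (v k)).exists_affine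
  refine ⟨Hom.mk m ⟨AffineMap.pi fun k => (l k).comp (g k), fun q => ?_⟩, ?_, ?_⟩
  · ext k
    rw [hl, hm, hg]
    rfl
  · exact fun u => hom_ext fun q => hm q u
  · intro m' hm'
    refine hom_ext fun q => Subtype.ext (funext fun k => ?_)
    rw [hl, hl, ← comp_toFun, hm']
    exact congrArg (fun y => l k y.1) (hm q (v k)).symm

section Maps

variable {A : SL}

/-- A linear functional, as a morphism to `ℝ`. -/
def ofFunctional (l : (Fin A.dim → ℝ) →ₗ[ℝ] ℝ) : A ⟶ space 1 :=
  ofAffine (B := space 1) (LinearMap.pi fun _ : Fin 1 => l).toAffineMap fun _ _ => trivial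

/-- A pair of linear functionals, as a morphism to `ℝ²`. -/
def ofFunctionals (l l' : (Fin A.dim → ℝ) →ₗ[ℝ] ℝ) : A ⟶ space 2 :=
  ofAffine (B := space 2) (LinearMap.pi ![l, l']).toAffineMap fun _ _ => trivial

/-- A nonnegative linear functional, as a morphism to `[0, ∞)`. -/
def toRay (l : (Fin A.dim → ℝ) →ₗ[ℝ] ℝ) (h : ∀ x ∈ A.carrier, 0 ≤ l x) : A ⟶ ray :=
  ofAffine (B := ray) (LinearMap.pi fun _ : Fin 1 => l).toAffineMap h

end Maps

/-! ### The orthant as the solution set of a circuit of additions and sign conditions. -/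

theorem isSemilinear_orthant (m : ℕ) : IsSemilinear {x : Fin m → ℝ | ∀ i, 0 ≤ x i} := by
  refine IsBasicSemilinear.isSemilinear ?_
  have := isBasicSemilinear_biInter (Set.finite_univ (α := Fin m)) fun i _ =>
    isBasicSemilinear_nonneg
      (LinearMap.proj (R := ℝ) (φ := fun _ : Fin m => ℝ) i).toAffineMap
  have h : {x : Fin m → ℝ | ∀ i, 0 ≤ x i} = ⋂ i ∈ Set.univ, {x | 0 ≤
      (LinearMap.proj (R := ℝ) (φ := fun _ : Fin m => ℝ) i).toAffineMap x} := by
    ext x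
    simp only [Set.mem_ofPred_eq, Set.mem_iInter, LinearMap.coe_toAffineMap,
      LinearMap.proj_apply]
    exact ⟨fun h i _ => h i, fun h i => h i trivial⟩
  rwa [h]

/-- The orthant `[0, ∞)^m`. -/
abbrev orthant (m : ℕ) : SL := ⟨m, {x | ∀ i, 0 ≤ x i}, isSemilinear_orthant m⟩

/-- The vertices of a diagram that expresses `y i = x i + z i` and `s (i + 1) = s i + y i` for
`i < n`, with nonnegative `s 0`, `y i` and `z i`. -/
inductive Node (n : ℕ) : Type
  | rs : Node n
  | ry (i : Fin n) : Node n
  | rz (i : Fin n) : Node n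
  | s (k : Fin (n + 1)) : Node n
  | x (i : Fin n) : Node n
  | y (i : Fin n) : Node n
  | z (i : Fin n) : Node n
  | p (i : Fin n) : Node n
  | q (i : Fin n) : Node n

/-- The edges of this diagram. -/
inductive Wire (n : ℕ) : Node n → Node n → Type
  | rs : Wire n .rs (.s 0)
  | ry (i : Fin n) : Wire n (.ry i) (.y i)
  | rz (i : Fin n) : Wire n (.rz i) (.z i)
  | px (i : Fin n) : Wire n (.p i) (.x i)
  | pz (i : Fin n) : Wire n (.p i) (.z i)
  | pa (i : Fin n) : Wire n (.p i) (.y i)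
  | qs (i : Fin n) : Wire n (.q i) (.s i.castSucc)
  | qy (i : Fin n) : Wire n (.q i) (.y i)
  | qa (i : Fin n) : Wire n (.q i) (.s i.succ)

variable {n : ℕ}

/-- The objects of the diagram. -/
abbrev nodeObj : Node n → SL
  | .rs => ray
  | .ry _ => ray
  | .rz _ => ray
  | .s _ => space 1
  | .x _ => space 1
  | .y _ => space 1
  | .z _ => space 1
  | .p _ => space 2
  | .q _ => space 2

/-- The morphisms of the diagram. -/
def wireMap : ∀ {u v : Node n}, Wire n u v → (nodeObj u ⟶ nodeObj v)
  | _, _, .rs => rayInclusion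
  | _, _, .ry _ => rayInclusion
  | _, _, .rz _ => rayInclusion
  | _, _, .px _ => proj 0
  | _, _, .pz _ => proj 1
  | _, _, .pa _ => add
  | _, _, .qs _ => proj 0
  | _, _, .qy _ => proj 1
  | _, _, .qa _ => add

theorem basic_or_projections_wireMap {u v : Node n} (e : Wire n u v) :
    (basic ⊔ projections) (wireMap e) := by
  cases e
  · exact .inl .rayInclusion
  · exact .inl .rayInclusion
  · exact .inl .rayInclusion
  · exact .inr (.proj 0)
  · exact .inr (.proj 1)
  · exact .inl .add
  · exact .inr (.proj 0)
  · exact .inr (.proj 1)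
  · exact .inl .add

variable (n) in
/-- The diagram. -/
def circuit : Diagram SL where
  V := Node n
  E := Wire n
  obj := nodeObj
  map := wireMap

/-! The coordinates of `[0, ∞)^(2n+1)` are called `s 0`, `y i` and `z i`. -/

/-- The coordinate `y i`. -/
abbrev yCoord (i : Fin n) : (Fin (n + n + 1) → ℝ) →ₗ[ℝ] ℝ :=
  LinearMap.proj (R := ℝ) (φ := fun _ => ℝ) (Fin.castAdd n i).succ

/-- The coordinate `z i`. -/
abbrev zCoord (i : Fin n) : (Fin (n + n + 1) → ℝ) →ₗ[ℝ] ℝ :=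
  LinearMap.proj (R := ℝ) (φ := fun _ => ℝ) (Fin.natAdd n i).succ

/-- The partial sum `s k` of `s 0` and the `y i` with `i < k`. -/
def sCoord (k : Fin (n + 1)) : (Fin (n + n + 1) → ℝ) →ₗ[ℝ] ℝ :=
  LinearMap.proj (R := ℝ) (φ := fun _ => ℝ) 0 +
    ∑ j ∈ Finset.univ.filter fun j : Fin n => j.castSucc < k, yCoord j

theorem sCoord_zero : sCoord (0 : Fin (n + 1)) = LinearMap.proj (R := ℝ) (φ := fun _ => ℝ) 0 := by
  simp [sCoord]

theorem sCoord_succ (i : Fin n) : sCoord i.succ = sCoord i.castSucc + yCoord i := by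
  have : (Finset.univ.filter fun j : Fin n => j.castSucc < i.succ) =
      insert i (Finset.univ.filter fun j : Fin n => j.castSucc < i.castSucc) := by
    ext j
    simp only [Finset.mem_filter, Finset.mem_univ, true_and, Finset.mem_insert, Fin.lt_def,
      Fin.ext_iff, Fin.val_castSucc, Fin.val_succ]
    omega
  rw [sCoord, this, Finset.sum_insert (by simp), sCoord]
  abel

theorem sCoord_last : sCoord (Fin.last n) = LinearMap.proj (R := ℝ) (φ := fun _ => ℝ) 0 +
    ∑ j : Fin n, yCoord j := by
  rw [sCoord, Finset.filter_true_of_mem fun j _ => Fin.castSucc_lt_last j]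

/-- The point with given coordinates. -/
def ofCoords (s : ℝ) (y z : Fin n → ℝ) : Fin (n + n + 1) → ℝ := Fin.cons s (Fin.append y z)

theorem ofCoords_zero (s : ℝ) (y z : Fin n → ℝ) : ofCoords s y z 0 = s := rfl

theorem yCoord_ofCoords (s : ℝ) (y z : Fin n → ℝ) (i : Fin n) :
    yCoord i (ofCoords s y z) = y i :=
  (Fin.cons_succ (α := fun _ => ℝ) s _ _).trans (Fin.append_left _ _ i)

theorem zCoord_ofCoords (s : ℝ) (y z : Fin n → ℝ) (i : Fin n) :
    zCoord i (ofCoords s y z) = z i :=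
  (Fin.cons_succ (α := fun _ => ℝ) s _ _).trans (Fin.append_right _ _ i)

theorem ofCoords_mem_orthant {s : ℝ} {y z : Fin n → ℝ} (hs : 0 ≤ s) (hy : ∀ i, 0 ≤ y i)
    (hz : ∀ i, 0 ≤ z i) : ofCoords s y z ∈ (orthant (n + n + 1)).carrier := by
  refine Fin.cases hs (Fin.addCases (fun i => ?_) fun i => ?_)
  · exact (hy i).trans_eq (yCoord_ofCoords s y z i).symm
  · exact (hz i).trans_eq (zCoord_ofCoords s y z i).symm

/-- The legs of the limit cone over the diagram. -/
def leg : ∀ v : Node n, orthant (n + n + 1) ⟶ nodeObj v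
  | .rs => toRay (LinearMap.proj (R := ℝ) (φ := fun _ => ℝ) 0) fun _ h => h _
  | .ry i => toRay (A := orthant (n + n + 1)) (yCoord i) fun _ h => h _
  | .rz i => toRay (A := orthant (n + n + 1)) (zCoord i) fun _ h => h _
  | .s k => ofFunctional (A := orthant (n + n + 1)) (sCoord k)
  | .x i => ofFunctional (A := orthant (n + n + 1)) (yCoord i - zCoord i)
  | .y i => ofFunctional (A := orthant (n + n + 1)) (yCoord i)
  | .z i => ofFunctional (A := orthant (n + n + 1)) (zCoord i)
  | .p i => ofFunctionals (A := orthant (n + n + 1)) (yCoord i - zCoord i) (zCoord i)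
  | .q i => ofFunctionals (A := orthant (n + n + 1)) (sCoord i.castSucc) (yCoord i)

theorem leg_wireMap {u v : Node n} (e : Wire n u v) : leg u ≫ wireMap e = leg v := by
  refine hom_ext fun t => Subtype.ext ?_
  cases e with
  | rs => exact funext fun _ => (LinearMap.congr_fun sCoord_zero t.1).symm
  | ry i => rfl
  | rz i => rfl
  | px i => rfl
  | pz i => rfl
  | pa i => exact funext fun _ => sub_add_cancel (yCoord i t.1) (zCoord i t.1)
  | qs i => rfl
  | qy i => rfl
  | qa i => exact funext fun _ => (LinearMap.congr_fun (sCoord_succ i) t.1).symm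

/-- The values at the half-lines determine the point `t`. Agreement spreads forward along the edges;
at the pairs `p i` and `q i`, which have no incoming edges, it is obtained from their targets. -/
theorem exists_leg_eq (x : ∀ v : Node n, (nodeObj v).carrier)
    (hx : ∀ (u v : Node n) (e : Wire n u v), (wireMap e).toFun (x u) = x v) :
    ∃ t, ∀ v, (leg v).toFun t = x v := by
  let s : ℝ := (x .rs).1 (0 : Fin 1)
  let y : Fin n → ℝ := fun i => (x (.ry i)).1 (0 : Fin 1)
  let z : Fin n → ℝ := fun i => (x (.rz i)).1 (0 : Fin 1)
  let t : (orthant (n + n + 1)).carrier := ⟨ofCoords s y z,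
    ofCoords_mem_orthant (x .rs).2 (fun i => (x (.ry i)).2) fun i => (x (.rz i)).2⟩
  have hrs : (leg .rs).toFun t = x .rs := Subtype.ext <| funext fun k => by
    rw [Subsingleton.elim k (0 : Fin 1)]; rfl
  have hry : ∀ i, (leg (.ry i)).toFun t = x (.ry i) := fun i => Subtype.ext <| funext fun k => by
    rw [Subsingleton.elim k (0 : Fin 1)]; exact yCoord_ofCoords s y z i
  have hrz : ∀ i, (leg (.rz i)).toFun t = x (.rz i) := fun i => Subtype.ext <| funext fun k => by
    rw [Subsingleton.elim k (0 : Fin 1)]; exact zCoord_ofCoords s y z i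
  have push : ∀ {u v : Node n} (e : Wire n u v), (leg u).toFun t = x u →
      (leg v).toFun t = x v := fun e h => by
    rw [← leg_wireMap e, comp_toFun, h, hx]
  have hy := fun i => push (.ry i) (hry i)
  have hz := fun i => push (.rz i) (hrz i)
  -- The pair `(x i, z i)` is recovered from `z i` and the sum `y i = x i + z i`.
  have hp : ∀ i, (leg (.p i)).toFun t = x (.p i) := by
    intro i
    have h1 : zCoord i t.1 = (x (.p i)).1 (1 : Fin 2) :=
      congrFun (congrArg Subtype.val ((hz i).trans (hx _ _ (.pz i)).symm)) (0 : Fin 1)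
    have h2 : yCoord i t.1 = (x (.p i)).1 (0 : Fin 2) + (x (.p i)).1 (1 : Fin 2) :=
      congrFun (congrArg Subtype.val ((hy i).trans (hx _ _ (.pa i)).symm)) (0 : Fin 1)
    refine Subtype.ext (funext (Fin.forall_fin_two.2 ⟨?_, h1⟩))
    change yCoord i t.1 - zCoord i t.1 = _
    rw [h1, h2, add_sub_cancel_right]
  have hq : ∀ i : Fin n, (leg (.s i.castSucc)).toFun t = x (.s i.castSucc) →
      (leg (.q i)).toFun t = x (.q i) := by
    intro i h
    have h1 : sCoord i.castSucc t.1 = (x (.q i)).1 (0 : Fin 2) :=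
      congrFun (congrArg Subtype.val (h.trans (hx _ _ (.qs i)).symm)) (0 : Fin 1)
    have h2 : yCoord i t.1 = (x (.q i)).1 (1 : Fin 2) :=
      congrFun (congrArg Subtype.val ((hy i).trans (hx _ _ (.qy i)).symm)) (0 : Fin 1)
    exact Subtype.ext (funext (Fin.forall_fin_two.2 ⟨h1, h2⟩))
  -- The partial sums depend on each other: `s k` gives `q k`, and `q k` gives the next sum.
  have hs : ∀ k, (leg (.s k)).toFun t = x (.s k) :=
    Fin.induction (push .rs hrs) fun i h => push (.qa i) (hq i h)
  refine ⟨t, fun v => ?_⟩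
  cases v with
  | rs => exact hrs
  | ry i => exact hry i
  | rz i => exact hrz i
  | s k => exact hs k
  | x i => exact push (.px i) (hp i)
  | y i => exact hy i
  | z i => exact hz i
  | p i => exact hp i
  | q i => exact hq i (hs _)

/-! ### The cone map as a leg of a limit. -/

/-- The linear map `(s 0, y, z) ↦ (s n, y - z)`. -/
def coneMapLinear (n : ℕ) : (Fin (n + n + 1) → ℝ) →ₗ[ℝ] (Fin (n + 1) → ℝ) :=
  LinearMap.pi (Fin.cons (sCoord (Fin.last n)) fun i => yCoord i - zCoord i)

/-- The restriction of `coneMapLinear n` to the orthant; its image is the set of all `(t, x)` with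
`∑ max (x i) 0 ≤ t`, a cone with `2 ^ n` facets through the origin. -/
def coneMap (n : ℕ) : orthant (n + n + 1) ⟶ space (n + 1) :=
  ofAffine (B := space (n + 1)) (coneMapLinear n).toAffineMap fun _ _ => trivial

/-- The vertices `s n` and `x i`. -/
def IsOutput : Node n → Prop
  | .s k => k = Fin.last n
  | .x _ => True
  | _ => False

/-- The coordinates of the target of `coneMap`. -/
def outputLeg : ∀ v : Node n, IsOutput v → (space (n + 1) ⟶ nodeObj v)
  | .s _, _ => ofFunctional (A := space (n + 1)) (LinearMap.proj (R := ℝ) (φ := fun _ => ℝ) 0)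
  | .x i, _ => ofFunctional (A := space (n + 1)) (LinearMap.proj (R := ℝ) (φ := fun _ => ℝ) i.succ)

theorem coneMap_outputLeg (v : Node n) (hv : IsOutput v) : coneMap n ≫ outputLeg v hv = leg v := by
  cases v with
  | s k =>
    obtain rfl : k = Fin.last n := hv
    rfl
  | x i => rfl
  | _ => exact hv.elim

theorem isEmpty_wire_of_isOutput {u v : Node n} (hu : IsOutput u) : Wire n u v → False := by
  intro e
  cases e <;> exact hu

variable (n) in
/-- The product `ℝ^(n+1)` of the outputs, as a cone. -/
def outputCone : ((circuit n).restrict {v | IsOutput v}).Cone where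
  pt := space (n + 1)
  π v := outputLeg v.1 v.2
  w {u _} e := (isEmpty_wire_of_isOutput u.2 e).elim

/-- No edge leaves an output, so the outputs span a discrete subdiagram and the limit is their
product. -/
theorem isLimit_outputCone : (outputCone n).IsLimit := by
  let V := ((circuit n).restrict {v | IsOutput v}).V
  let s : V := ⟨.s (Fin.last n), rfl⟩
  let x : Fin n → V := fun i => ⟨.x i, trivial⟩
  let l : (Fin 1 → ℝ) →ᵃ[ℝ] ℝ := (LinearMap.proj (R := ℝ) (φ := fun _ : Fin 1 => ℝ) 0).toAffineMap
  refine isLimit_of_coordinates ?_ fun f _ => ?_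
  · exact Fin.cases ⟨s, l, fun _ => rfl⟩ fun i => ⟨x i, l, fun _ => rfl⟩
  · refine ⟨⟨Fin.cons ((f s).1 (0 : Fin 1)) fun i => (f (x i)).1 (0 : Fin 1), trivial⟩, ?_⟩
    rintro ⟨v, hv⟩
    cases v with
    | s k =>
      obtain rfl : k = Fin.last n := hv
      exact Subtype.ext (funext (Fin.forall_fin_one.2 rfl))
    | x i => exact Subtype.ext (funext (Fin.forall_fin_one.2 rfl))
    | _ => exact hv.elim

variable (n) in
/-- The diagram with the product of the outputs. -/
abbrev circuitWithOutput : Diagram SL :=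
  (circuit n).addCone {v | IsOutput v} (outputCone n)

variable (n) in
/-- The legs of the cone over the diagram with the product of the outputs. -/
def totalLeg : ∀ v : (circuitWithOutput n).V, orthant (n + n + 1) ⟶ (circuitWithOutput n).obj v
  | none => coneMap n
  | some v => leg v

variable (n) in
/-- The orthant as a cone over the diagram with the product of the outputs. -/
def totalCone : ((circuitWithOutput n).restrict Set.univ).Cone where
  pt := orthant (n + n + 1)
  π v := totalLeg n v.1
  w {u v} e := by
    obtain ⟨_ | u, _⟩ := u <;> obtain ⟨_ | v, _⟩ := v
    · exact e.elim
    · exact coneMap_outputLeg v e.down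
    · exact e.elim
    · exact leg_wireMap e

/-- The product vertex adds no freedom: its edges to the outputs are its coordinates, whose values
are already fixed by the point of the orthant. -/
theorem isLimit_totalCone : (totalCone n).IsLimit := by
  let V := ((circuitWithOutput n).restrict Set.univ).V
  let node : Node n → V := fun v => ⟨some v, trivial⟩
  let l : (Fin 1 → ℝ) →ᵃ[ℝ] ℝ := (LinearMap.proj (R := ℝ) (φ := fun _ : Fin 1 => ℝ) 0).toAffineMap
  refine isLimit_of_coordinates ?_ fun f hf => ?_
  · exact Fin.cases ⟨node .rs, l, fun _ => rfl⟩ (Fin.addCases (m := n) (n := n)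
      (fun i => ⟨node (.ry i), l, fun _ => rfl⟩) fun i => ⟨node (.rz i), l, fun _ => rfl⟩)
  · obtain ⟨t, ht⟩ := exists_leg_eq (fun v => f (node v)) fun u v e => hf (node u) (node v) e
    refine ⟨t, ?_⟩
    rintro ⟨_ | v, _⟩
    · have hout : ∀ v (hv : IsOutput v),
          (outputLeg v hv).toFun (f ⟨none, trivial⟩) = (outputLeg v hv).toFun
            ((coneMap n).toFun t) := fun v hv => by
        rw [← comp_toFun, coneMap_outputLeg, ht]
        exact hf ⟨none, trivial⟩ (node v) ⟨hv⟩
      refine Subtype.ext (funext (Fin.cases ?_ fun i => ?_))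
      · exact (congrFun (congrArg Subtype.val (hout (.s (Fin.last n)) rfl)) (0 : Fin 1)).symm
      · exact (congrFun (congrArg Subtype.val (hout (.x i) trivial)) (0 : Fin 1)).symm
    · exact ht v

/-! ### The cost of computing the cone map. -/

theorem circuit_edges_surjective : ∃ g : Option (Fin 8 × Fin n) →
    (Σ p : (circuit n).V × (circuit n).V, (circuit n).E p.1 p.2), Function.Surjective g := by
  refine ⟨fun a => match a with
    | none => ⟨(_, _), Wire.rs⟩
    | some (0, i) => ⟨(_, _), Wire.ry i⟩
    | some (1, i) => ⟨(_, _), Wire.rz i⟩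
    | some (2, i) => ⟨(_, _), Wire.px i⟩
    | some (3, i) => ⟨(_, _), Wire.pz i⟩
    | some (4, i) => ⟨(_, _), Wire.pa i⟩
    | some (5, i) => ⟨(_, _), Wire.qs i⟩
    | some (6, i) => ⟨(_, _), Wire.qy i⟩
    | some (7, i) => ⟨(_, _), Wire.qa i⟩, ?_⟩
  rintro ⟨⟨u, v⟩, e⟩
  cases e with
  | rs => exact ⟨none, rfl⟩
  | ry i => exact ⟨some (0, i), rfl⟩
  | rz i => exact ⟨some (1, i), rfl⟩
  | px i => exact ⟨some (2, i), rfl⟩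
  | pz i => exact ⟨some (3, i), rfl⟩
  | pa i => exact ⟨some (4, i), rfl⟩
  | qs i => exact ⟨some (5, i), rfl⟩
  | qy i => exact ⟨some (6, i), rfl⟩
  | qa i => exact ⟨some (7, i), rfl⟩

theorem circuit_edgeCount_le : (circuit n).edgeCount ≤ 8 * n + 1 := by
  obtain ⟨g, hg⟩ := circuit_edges_surjective (n := n)
  refine (Nat.card_le_card_of_surjective g hg).trans ?_
  simp [Nat.card_eq_fintype_card]

theorem exists_edge_circuit (v : (circuit n).V) :
    ∃ u : (circuit n).V, Nonempty ((circuit n).E u v) ∨ Nonempty ((circuit n).E v u) := by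
  cases v with
  | rs => exact ⟨_, .inr ⟨Wire.rs⟩⟩
  | ry i => exact ⟨_, .inr ⟨Wire.ry i⟩⟩
  | rz i => exact ⟨_, .inr ⟨Wire.rz i⟩⟩
  | s k => exact Fin.cases ⟨_, .inl ⟨Wire.rs⟩⟩ (fun i => ⟨_, .inl ⟨Wire.qa i⟩⟩) k
  | x i => exact ⟨_, .inl ⟨Wire.px i⟩⟩
  | y i => exact ⟨_, .inl ⟨Wire.ry i⟩⟩
  | z i => exact ⟨_, .inl ⟨Wire.rz i⟩⟩
  | p i => exact ⟨_, .inr ⟨Wire.px i⟩⟩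
  | q i => exact ⟨_, .inr ⟨Wire.qs i⟩⟩

theorem circuit_isFinite : (circuit n).IsFinite := by
  obtain ⟨g, hg⟩ := circuit_edges_surjective (n := n)
  have hE := Finite.of_surjective g hg
  refine ⟨?_, hE⟩
  let h : (Σ p : (circuit n).V × (circuit n).V, (circuit n).E p.1 p.2) × Bool → (circuit n).V :=
    fun e => cond e.2 e.1.1.1 e.1.1.2
  refine Finite.of_surjective h fun v => ?_
  obtain ⟨u, ⟨⟨e⟩⟩ | ⟨⟨e⟩⟩⟩ := exists_edge_circuit v
  · exact ⟨(⟨(u, v), e⟩, false), rfl⟩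
  · exact ⟨(⟨(v, u), e⟩, true), rfl⟩

/-- Two limits are added to the circuit: the product of the outputs, then the limit over all
vertices including this product. The leg from the second to the first is `coneMap n`. -/
theorem arrowLimitComplexity_coneMap_le {𝒜 : MorphismProperty SL}
    (h𝒜 : basic ⊔ projections ≤ 𝒜) (n : ℕ) :
    arrowLimitComplexity 𝒜 (single (Arrow.mk (coneMap n))) ≤ (8 * n + 3 : ℕ) := by
  have hD : LimitComputation 𝒜 (circuit n) (fun _ => ∅) (circuit n).edgeCount :=
    .init _ circuit_isFinite (fun u v e => h𝒜 _ (basic_or_projections_wireMap e))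
      exists_edge_circuit
  have hD' := (hD.step _ _ _ {v | IsOutput v} (by simp) _ isLimit_outputCone).step _ _ _
    Set.univ (fun _ _ => Set.subset_univ _) _ isLimit_totalCone
  suffices arrowLimitComplexity 𝒜 (single (Arrow.mk (coneMap n))) ≤
      ((circuit n).edgeCount + 1 + 1 : ℕ) from
    this.trans (Nat.cast_le.2 (Nat.add_le_add_right circuit_edgeCount_le 2))
  refine sInf_le ⟨_, _, _, hD', ?_, rfl⟩
  -- The source is the last vertex added, the target the one added before it.
  let a : Unit × Bool → Option (Option (Node n)) := fun v => cond v.2 (some none) none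
  let X := (single (Arrow.mk (coneMap n))).ofArrow
  let Y := (circuitWithOutput n).addCone Set.univ (totalCone n)
  let b : ∀ u v : Unit × Bool, X.E u v → Y.E (a u) (a v) := fun u v e => match u, v, e with
    | (_, false), (_, true), _ => ⟨trivial⟩
  let φ : ∀ v : Unit × Bool, X.obj v ≅ Y.obj (a v) := fun v => match v with
    | (_, false) => Iso.refl (orthant (n + n + 1))
    | (_, true) => Iso.refl (space (n + 1))
  refine ⟨a, b, φ, ?_, ?_, ?_⟩
  · rintro ⟨_, _ | _⟩ ⟨_, _ | _⟩ h
    · rfl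
    · cases h
    · cases h
    · rfl
  · rintro ⟨_, _ | _⟩ ⟨_, _ | _⟩ e e' h
    · exact e.elim
    · exact congrArg PLift.up (Subsingleton.elim e.down e'.down)
    · exact e.elim
    · exact e.elim
  · rintro ⟨_, _ | _⟩ ⟨_, _ | _⟩ e
    · exact e.elim
    · rfl
    · exact e.elim
    · exact e.elim

/-! ### The facets of the image -/

theorem coneMapLinear_zero (v : Fin (n + n + 1) → ℝ) :
    coneMapLinear n v 0 = v 0 + ∑ i : Fin n, yCoord i v := by
  change sCoord (Fin.last n) v = _
  rw [sCoord_last, LinearMap.add_apply, LinearMap.sum_apply]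
  rfl

theorem coneMapLinear_succ (v : Fin (n + n + 1) → ℝ) (i : Fin n) :
    coneMapLinear n v i.succ = yCoord i v - zCoord i v := rfl

theorem coneMapLinear_ofCoords (s : ℝ) (y z : Fin n → ℝ) :
    coneMapLinear n (ofCoords s y z) =
      (Fin.cons (s + ∑ i, y i) fun i => y i - z i : Fin (n + 1) → ℝ) := by
  refine funext (Fin.cases ?_ fun i => ?_)
  · simp only [coneMapLinear_zero, ofCoords_zero, yCoord_ofCoords, Fin.cons_zero]
  · simp only [coneMapLinear_succ, yCoord_ofCoords, zCoord_ofCoords, Fin.cons_succ]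

/-- Together with `quot_coneMap_eq_zero`, this allows affine relations in the abstract image to be
tested after applying `coneMapLinear n`. -/
theorem coneMapLinear_quot (v : Fin (n + n + 1) → ℝ) :
    coneMapLinear n (quot (coneMap n) v) = coneMapLinear n v :=
  affine_quot (coneMap n) (coneMap n) (fun _ _ h => h) (coneMapLinear n).toAffineMap
    (fun _ => rfl) v

/-- The orthant spans the whole space by differences: `w` is its positive part minus its negative
part, and `coneMap n` identifies these two when `w` is in the kernel. -/
theorem quot_coneMap_eq_zero {w : Fin (n + n + 1) → ℝ} (hw : coneMapLinear n w = 0) :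
    quot (coneMap n) w = 0 := by
  let x : (orthant (n + n + 1)).carrier := ⟨fun i => max (w i) 0, fun i => le_max_right _ _⟩
  let y : (orthant (n + n + 1)).carrier := ⟨fun i => max (-w i) 0, fun i => le_max_right _ _⟩
  have hxy : x.1 - y.1 = w := funext fun i => max_zero_sub_max_neg_zero_eq_self (w i)
  have h : (coneMap n).toFun x = (coneMap n).toFun y := by
    refine Subtype.ext (sub_eq_zero.1 ?_)
    change coneMapLinear n x.1 - coneMapLinear n y.1 = 0
    rw [← map_sub, hxy, hw]
  have := quot_eq (coneMap n) h
  rw [← hxy, map_sub, this, sub_self]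

/-- The indicator function of a subset of `Fin n`. -/
def indic (S : Fin n → Bool) (i : Fin n) : ℝ := if S i then 1 else 0

theorem indic_eq (S : Fin n → Bool) (i : Fin n) : indic S i = 0 ∨ indic S i = 1 := by
  unfold indic
  split_ifs <;> simp

theorem indic_nonneg (S : Fin n → Bool) (i : Fin n) : 0 ≤ indic S i := by
  rcases indic_eq S i with h | h <;> simp [h]

theorem one_sub_indic_nonneg (S : Fin n → Bool) (i : Fin n) : 0 ≤ 1 - indic S i := by
  rcases indic_eq S i with h | h <;> simp [h]

/-- The sum is the size of the symmetric difference of `S` and `T`. -/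
theorem one_le_sum_indic_sub_sq {S T : Fin n → Bool} (h : S ≠ T) :
    1 ≤ ∑ i, (indic S i - indic T i) ^ 2 := by
  obtain ⟨i, hi⟩ := Function.ne_iff.1 h
  refine le_trans ?_ (Finset.single_le_sum (f := fun i => (indic S i - indic T i) ^ 2)
    (fun j _ => sq_nonneg _) (Finset.mem_univ i))
  revert hi
  cases hS : S i <;> cases hT : T i <;> simp [indic, hS, hT]

/-- A point over the facet `∑ i ∈ S, x i = t` of the image (`s = 0`) or above it (`s > 0`). -/
def facetPoint (s : ℝ) (hs : 0 ≤ s) (S : Fin n → Bool) : (orthant (n + n + 1)).carrier :=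
  ⟨ofCoords s (indic S) fun i => 1 - indic S i,
    ofCoords_mem_orthant hs (indic_nonneg S) (one_sub_indic_nonneg S)⟩

/-- The facet point has `t = |S|`, and `x i` is `1` on `S` and `-1` off `S`. The reflection lowers
`t` by `1 / 2` below the facet; for a preimage in the orthant, `y i ≥ max (x i) 0` would force `t ≥
|S|`. -/
theorem not_hasReflection_facetPoint (S : Fin n → Bool) :
    ¬ HasReflection ((toCoim (coneMap n)).toFun (facetPoint (1 / 2) (by norm_num) S))
      ((toCoim (coneMap n)).toFun (facetPoint 0 le_rfl S)) := by
  rintro ⟨d, hd⟩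
  obtain ⟨t, rfl⟩ := toCoim_surjective _ d
  have h : coneMapLinear n t.1 +
        coneMapLinear n (ofCoords (1 / 2) (indic S) fun i => 1 - indic S i) =
      coneMapLinear n (ofCoords 0 (indic S) fun i => 1 - indic S i) +
        coneMapLinear n (ofCoords 0 (indic S) fun i => 1 - indic S i) := by
    rw [← coneMapLinear_quot t.1, ← coneMapLinear_quot (ofCoords (1 / 2) _ _),
      ← coneMapLinear_quot (ofCoords 0 _ _), ← map_add (coneMapLinear n),
      ← map_add (coneMapLinear n)]
    exact congrArg (coneMapLinear n) hd
  simp only [coneMapLinear_ofCoords] at h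
  have h0 := congrFun h 0
  simp only [Pi.add_apply, coneMapLinear_zero, Fin.cons_zero] at h0
  have hle : ∑ i, indic S i ≤ ∑ i, yCoord i t.1 := Finset.sum_le_sum fun i _ => by
    have hi := congrFun h i.succ
    simp only [Pi.add_apply, coneMapLinear_succ, Fin.cons_succ] at hi
    have hy : 0 ≤ yCoord i t.1 := t.2 _
    have hz : 0 ≤ zCoord i t.1 := t.2 _
    rcases indic_eq S i with h | h <;> rw [h] at hi ⊢ <;> linarith
  have ht : 0 ≤ t.1 0 := t.2 _
  linarith

/-- The midpoint of the facet points of `S` and `T` lies above the boundary of the cone by half the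
size of their symmetric difference, hence by at least `1 / 2`. This absorbs the displacement `1 / 2`
of the reflections. -/
theorem hasMidReflection_facetPoint {S T : Fin n → Bool} (hST : S ≠ T) :
    HasMidReflection ((toCoim (coneMap n)).toFun (facetPoint (1 / 2) (by norm_num) S))
      ((toCoim (coneMap n)).toFun (facetPoint 0 le_rfl S))
      ((toCoim (coneMap n)).toFun (facetPoint (1 / 2) (by norm_num) T))
      ((toCoim (coneMap n)).toFun (facetPoint 0 le_rfl T)) := by
  have h1 := one_le_sum_indic_sub_sq hST
  -- A preimage of the midpoint: `y` and `z` are the positive and negative parts of its coordinates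
  -- `indic S + indic T - 1`, and `s 0` is the remaining slack.
  let c : (orthant (n + n + 1)).carrier :=
    ⟨ofCoords ((∑ i, (indic S i - indic T i) ^ 2 - 1) / 2) (fun i => indic S i * indic T i)
      fun i => (1 - indic S i) * (1 - indic T i),
      ofCoords_mem_orthant (by linarith) (fun i => mul_nonneg (indic_nonneg S i) (indic_nonneg T i))
        fun i => mul_nonneg (one_sub_indic_nonneg S i) (one_sub_indic_nonneg T i)⟩
  refine ⟨(toCoim (coneMap n)).toFun c, ?_⟩
  change quot (coneMap n) _ + quot (coneMap n) _ + (quot (coneMap n) _ + quot (coneMap n) _) =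
    quot (coneMap n) _ + quot (coneMap n) _ + (quot (coneMap n) _ + quot (coneMap n) _)
  simp only [← map_add]
  rw [← sub_eq_zero, ← map_sub]
  refine quot_coneMap_eq_zero ?_
  simp only [map_sub, map_add, c, facetPoint, coneMapLinear_ofCoords]
  refine funext (Fin.cases ?_ fun i => ?_)
  · simp only [Pi.sub_apply, Pi.add_apply, Fin.cons_zero, Pi.zero_apply]
    -- Indicators equal their squares.
    have hsq : ∑ i, (indic S i - indic T i) ^ 2 =
        ∑ i, indic S i + ∑ i, indic T i - 2 * ∑ i, indic S i * indic T i := by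
      rw [Finset.mul_sum, ← Finset.sum_add_distrib, ← Finset.sum_sub_distrib]
      refine Finset.sum_congr rfl fun i _ => ?_
      rcases indic_eq S i with h | h <;> rcases indic_eq T i with h' | h' <;> rw [h, h'] <;>
        norm_num
    rw [hsq]
    ring
  · simp only [Pi.sub_apply, Pi.add_apply, Fin.cons_succ, Pi.zero_apply]
    ring

theorem two_pow_le_of_reflectionBound {k : ℕ} (h : ReflectionBound (coim (coneMap n)) k) :
    2 ^ n ≤ k := by
  have := h (Fin n → Bool) _ _ (fun S T hST => hasMidReflection_facetPoint hST)
    not_hasReflection_facetPoint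
  simpa [Nat.card_eq_fintype_card] using this

/-! ### Exponential lower bound against polynomial growth. -/

theorem le_monoLimitComplexity_coneMap {𝒜 : MorphismProperty SL}
    (h𝒜 : 𝒜 ≤ basic ⊔ projections ⊔ constants) {m : ℕ}
    (h : monoLimitComplexity 𝒜 ((single (Arrow.mk (coneMap n))).mapFunctor im) ≤ m) :
    2 ^ n ≤ 2 * m := by
  -- Passing to the strict bound `m + 1` extracts an actual computation from the infimum.
  obtain ⟨_, ⟨Y, gen, N, hY, ⟨a, b, φ, -⟩, rfl⟩, hN⟩ :=
    sInf_lt_iff.1 (h.trans_lt (Nat.cast_lt.2 m.lt_succ_self))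
  have hN' : N < m + 1 := Nat.cast_lt.1 hN
  let ψ : coim (coneMap n) ≅ Y.obj (a ((), false)) := φ ((), false)
  have := two_pow_le_of_reflectionBound
    ((reflectionBound_of_limitComputation h𝒜 hY (a ((), false))).of_iso ψ)
  omega

open Filter in
theorem exists_polynomial_eval_lt_two_pow (q : Polynomial ℕ) : ∃ n : ℕ, q.eval n < 2 ^ n := by
  -- The substitution `x / log 2` turns the comparison with `exp` at `n * log 2` into one of `q n`
  -- with `2 ^ n`.
  let r : Polynomial ℝ :=
    (q.map (Nat.castRingHom ℝ)).comp (Polynomial.C (Real.log 2)⁻¹ * Polynomial.X)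
  have h2 : 0 < Real.log 2 := Real.log_pos one_lt_two
  have ht : Tendsto (fun n : ℕ => Real.log 2 * (n : ℝ)) atTop atTop :=
    tendsto_natCast_atTop_atTop.const_mul_atTop h2
  obtain ⟨n, hn⟩ := (((Polynomial.tendsto_div_exp_atTop r).comp ht).eventually_lt_const
    zero_lt_one).exists
  refine ⟨n, ?_⟩
  have he : Real.exp (Real.log 2 * n) = 2 ^ n := by
    rw [mul_comm, Real.exp_nat_mul, Real.exp_log two_pos]
  simp only [Function.comp_apply, he] at hn
  rw [div_lt_one (by positivity)] at hn
  have hr : r.eval (Real.log 2 * n) = (q.eval n : ℕ) := by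
    simp only [r, Polynomial.eval_comp, Polynomial.eval_mul, Polynomial.eval_C, Polynomial.eval_X,
      inv_mul_cancel_left₀ h2.ne']
    rw [Polynomial.eval_natCast_map]
    simp
  rw [hr] at hn
  exact_mod_cast hn

theorem not_polynomiallyBounded_obj_im {𝒜 : MorphismProperty SL}
    (h : basic ⊔ projections ≤ 𝒜) (h' : 𝒜 ≤ basic ⊔ projections ⊔ constants) :
    ¬ PolynomiallyBounded
      (functorObjComplexity (arrowLimitComplexity 𝒜) (monoLimitComplexity 𝒜) im) := by
  rintro ⟨p, hp⟩
  -- The argument `8 * X + 3` is the cost of `coneMap n`; the factor `2` comes from the count of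
  -- initial vertices.
  obtain ⟨n, hn⟩ := exists_polynomial_eval_lt_two_pow
    (2 * p.comp (8 * Polynomial.X + 3))
  have hle := le_monoLimitComplexity_coneMap h' (n := n)
    ((le_iSup₂_of_le (f := fun (A : Arrow SL) (_ : arrowLimitComplexity 𝒜 (single A) ≤
      (8 * n + 3 : ℕ)) => monoLimitComplexity 𝒜 ((single A).mapFunctor im))
      _ (arrowLimitComplexity_coneMap_le h n) le_rfl).trans (hp (8 * n + 3)))
  simp only [Polynomial.eval_mul, Polynomial.eval_comp, Polynomial.eval_add, Polynomial.eval_X,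
    Polynomial.eval_ofNat] at hn
  omega

end SL

end CategoricalComplexity

/-- The image functor of the category of semi-linear sets is not polynomially bounded with respect
to limit complexity. Moreover, as soon as the two coordinate projections are among the basic
morphisms (with or without constants), this is already so for single morphisms. -/
theorem mainTheorem5 :
    ¬ PolynomiallyBounded
        (functorComplexity (arrowLimitComplexity SL.basic) (monoLimitComplexity SL.basic) SL.im) ∧
    ∀ 𝒜 : MorphismProperty SL, SL.basic ⊔ SL.projections ≤ 𝒜 →
      𝒜 ≤ SL.basic ⊔ SL.projections ⊔ SL.constants →
      ¬ PolynomiallyBounded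
        (functorObjComplexity (arrowLimitComplexity 𝒜) (monoLimitComplexity 𝒜) SL.im) :=
  ⟨SL.not_polynomiallyBounded_im, fun _ h h' => SL.not_polynomiallyBounded_obj_im h h'⟩
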